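/- **Setting.** Let $d\ge 1$ and $l\ge 0$ be fixed integers, $g:\mathbb R^d\times\mathbb R^l\to\mathbb R$ a given function, and $0<c$, $C$, $K$ constants. For every $n$ let $(X_1,Y_1),\dots,(X_n,Y_n)$ be i.i.d. copies of $(X,Y)\in\mathbb R^{p}\times\mathbb R$, where $p=p_n$ and the law of $(X,Y)$ may depend on $n$, with $p^2/n\to 0$. Assume $E|Y|<\infty$, $E(X)=0$, $\mathrm{Var}(X)=I_p$ and $E(X_{(k)}^4)\le K$ for every coordinate $X_{(k)}$ of $X$. The central subspace $\mathcal S_{Y|X}$ is the intersection of all column spaces $\mathrm{span}(A)$ such that $Y$ and $X$ are conditionally independent given $A^\top X$; the central mean subspace $\mathcal S_{E(Y|X)}$ is the intersection of all $\mathrm{span}(A)$ such that $Y$ and $E(Y|X)$ are conditionally independent given $A^\top X$. Let $$M=\int E[X\,I(Y\le t)]\,E[X^\top I(Y\le t)]\,dF_Y(t),$$ with eigenvalues $\lambda_1\ge\dots\ge\lambda_p$. **Estimators.** Let $\bar X$ and $\hat\Sigma$ be the sample mean and the sample covariance matrix (divisor $n$) of the $X_i$, $Z_i=\hat\Sigma^{-1/2}(X_i-\bar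 X)$ (with the Moore–Penrose inverse if $\hat\Sigma$ is singular), $\hat\alpha_t=\frac1n\sum_{i=1}^n Z_iI(Y_i\le t)$ and $\hat M=\frac1n\sum_{j=1}^n\hat\alpha_{Y_j}\hat\alpha_{Y_j}^\top$, with eigenvalues $\hat\lambda_1\ge\dots\ge\hat\lambda_p$. Let $c_n=\log n/n$, let $\hat q$ be any minimizer of $(\hat\lambda_{j+1}^2+c_n)/(\hat\lambda_j^2+c_n)$ over $1\le j\le p-1$, and let $\hat B(r)$ be any $p\times r$ matrix whose columns are orthonormal eigenvectors of $\hat M$ for its $r$ largest eigenvalues. **Conditions $(\mathcal C_r)$** on a $p\times r$ matrix $B=B_n$, for all $n$, with $1\le r<p$: $B^\top B=I_r$; $\mathrm{span}(B)=\mathcal S_{E(Y|X)}=\mathcal S_{Y|X}$; $Y$ and $X$ are conditionally independent given $B^\top X$ (the central subspace exists); for every $b\in\mathbb R^p$, $E(b^\top X\mid B^\top X)$ is almost surely an affine function of $B^\top X$ (linearity condition); the coordinates of $B^\top X$ have fourth moments at most $K$; and $c\le\lambda_r\le\lambda_1\le C$. For $p\times r$ matrices put $\mathrm{dist}(V,B)=\inf_O\|V-BO\|$,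 where $\|\cdot\|$ is the Frobenius norm and $O$ runs over the orthogonal $r\times r$ matrices; thus $BO$ runs over the orthonormal bases of $\mathrm{span}(B)$. **Theorem.** 1. Under $H_0$, i.e. $E(Y|X)=g(\beta_0^\top X,\vartheta_0)$ almost surely for some $\beta_0\in\mathbb R^{p\times d}$ of rank $d$ and $\vartheta_0\in\mathbb R^l$ (both may depend on $n$) with $\mathrm{span}(\beta_0)=\mathcal S_{E(Y|X)}$: if $B$ satisfies $(\mathcal C_d)$, then $\mathbb P(\hat q=d)\to1$ and $\mathrm{dist}(\hat B(d),B)=O_p(\sqrt{p/n})$. 2. Under $H_1$, i.e. $E(Y|X)=G(B^\top X)$ almost surely for some measurable $G$, and for no $\beta\in\mathbb R^{p\times d}$, $\vartheta\in\mathbb R^l$ is $E(Y|X)=g(\beta^\top X,\vartheta)$ almost surely: if $B$ satisfies $(\mathcal C_q)$, where $q=q_n$ may depend on $n$, then $\mathbb P(\hat q=q)\to1$ and $\mathrm{dist}(\hat B(q),B)=O_p(\sqrt{pq/n})$. -/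

import Mathlib

open MeasureTheory ProbabilityTheory Filter Topology
open scoped Matrix

noncomputable section

namespace CSE

/-- The range of values of one observation `(X, Y)`, with `X ∈ ℝᵖ` and `Y ∈ ℝ`. -/
abbrev Obs (p : ℕ) : Type := (Fin p → ℝ) × ℝ

/-- The linear reduction `(x, y) ↦ Aᵀ x`. -/
def reduce {p k : ℕ} (A : Matrix (Fin p) (Fin k) ℝ) (z : Obs p) : Fin k → ℝ :=
  Aᵀ *ᵥ z.1

lemma measurable_reduce {p k : ℕ} (A : Matrix (Fin p) (Fin k) ℝ) : Measurable (reduce A) := by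
  unfold reduce Matrix.mulVec dotProduct
  fun_prop

/-- `span(A)`, the subspace spanned by the columns of `A`. -/
def colSpan {p k : ℕ} (A : Matrix (Fin p) (Fin k) ℝ) : Submodule ℝ (Fin p → ℝ) :=
  Submodule.span ℝ (Set.range A.col)

/-! ### Sufficient dimension reduction at the population level -/

section Population

variable {p : ℕ} (P : Measure (Obs p))

/-- The regression function `E(Y | X)`, as a random variable under the law `P` of `(X, Y)`. -/
def condMeanY : Obs p → ℝ :=
  P[(fun z : Obs p => z.2) | MeasurableSpace.comap (fun z : Obs p => z.1) inferInstance]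

/-- `Y` and `X` are conditionally independent given `Aᵀ X`. -/
def IsSufficient [IsFiniteMeasure P] {k : ℕ} (A : Matrix (Fin p) (Fin k) ℝ) : Prop :=
  CondIndepFun (MeasurableSpace.comap (reduce A) inferInstance) (measurable_reduce A).comap_le
    (fun z : Obs p => z.2) (fun z : Obs p => z.1) P

/-- `Y` and `E(Y | X)` are conditionally independent given `Aᵀ X`. -/
def IsMeanSufficient [IsFiniteMeasure P] {k : ℕ} (A : Matrix (Fin p) (Fin k) ℝ) : Prop :=
  CondIndepFun (MeasurableSpace.comap (reduce A) inferInstance) (measurable_reduce A).comap_le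
    (fun z : Obs p => z.2) (condMeanY P) P

/-- The central subspace `S_{Y|X}`. -/
def centralSubspace [IsFiniteMeasure P] : Submodule ℝ (Fin p → ℝ) :=
  sInf {W | ∃ (k : ℕ) (A : Matrix (Fin p) (Fin k) ℝ), IsSufficient P A ∧ W = colSpan A}

/-- The central mean subspace `S_{E(Y|X)}`. -/
def centralMeanSubspace [IsFiniteMeasure P] : Submodule ℝ (Fin p → ℝ) :=
  sInf {W | ∃ (k : ℕ) (A : Matrix (Fin p) (Fin k) ℝ), IsMeanSufficient P A ∧ W = colSpan A}

/-- The vector `E[X h_t(Y)]` with `h_t(y) = 1` if `y ≤ t` and `0` otherwise. -/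
def cumMean (t : ℝ) : Fin p → ℝ :=
  fun k => ∫ z, z.1 k * (if z.2 ≤ t then 1 else 0) ∂P

/-- The target matrix `M = ∫ E[X h_t(Y)] E[Xᵀ h_t(Y)] dF_Y(t)`. -/
def targetMatrix : Matrix (Fin p) (Fin p) ℝ :=
  Matrix.of fun k l => ∫ t, cumMean P t k * cumMean P t l ∂(P.map Prod.snd)

lemma targetMatrix_isHermitian : (targetMatrix P).IsHermitian := by
  ext k l
  simp [targetMatrix, Matrix.conjTranspose_apply, mul_comm]

end Population

/-- The `j`-th largest eigenvalue of a symmetric matrix, counted with multiplicity,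
where `j = 1, …, p`. -/
def eig {p : ℕ} {A : Matrix (Fin p) (Fin p) ℝ} (hA : A.IsHermitian) (j : ℕ) : ℝ :=
  if h : j - 1 < p then hA.eigenvalues₀ ⟨j - 1, by simpa using h⟩ else 0

/-! ### The estimators -/

section Sample

variable {n p : ℕ} (D : Fin n → Obs p)

/-- The sample mean of the predictors. -/
def sampleMean : Fin p → ℝ :=
  fun k => (1 / (n : ℝ)) * ∑ i, (D i).1 k

/-- The sample covariance matrix of the predictors. -/
def sampleCov : Matrix (Fin p) (Fin p) ℝ :=
  Matrix.of fun k l =>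
    (1 / (n : ℝ)) * ∑ i, ((D i).1 k - sampleMean D k) * ((D i).1 l - sampleMean D l)

/-- `A^{-1/2}` for a positive definite matrix `A` (on a singular positive semidefinite matrix,
the square root of the Moore–Penrose inverse). -/
def invSqrt (A : Matrix (Fin p) (Fin p) ℝ) : Matrix (Fin p) (Fin p) ℝ :=
  cfc (fun x : ℝ => (Real.sqrt x)⁻¹) A

/-- The standardized predictors `Z_i`. -/
def stdPred (i : Fin n) : Fin p → ℝ :=
  invSqrt (sampleCov D) *ᵥ ((D i).1 - sampleMean D)

/-- The vector `(1/n) ∑ᵢ Z_i I(Y_i ≤ t)`. -/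
def cumMeanHat (t : ℝ) : Fin p → ℝ :=
  fun k => (1 / (n : ℝ)) * ∑ i, stdPred D i k * (if (D i).2 ≤ t then 1 else 0)

/-- The sample version of the target matrix. -/
def targetMatrixHat : Matrix (Fin p) (Fin p) ℝ :=
  Matrix.of fun k l =>
    (1 / (n : ℝ)) * ∑ j, cumMeanHat D (D j).2 k * cumMeanHat D (D j).2 l

lemma targetMatrixHat_isHermitian : (targetMatrixHat D).IsHermitian := by
  ext k l
  simp [targetMatrixHat, Matrix.conjTranspose_apply, mul_comm]

/-- The ridge constant `c_n = log n / n`. -/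
def ridge (n : ℕ) : ℝ := Real.log n / n

/-- The ridge-type ratio of consecutive squared eigenvalues of the sample target matrix. -/
def ridgeRatio (j : ℕ) : ℝ :=
  ((eig (targetMatrixHat_isHermitian D) (j + 1)) ^ 2 + ridge n) /
    ((eig (targetMatrixHat_isHermitian D) j) ^ 2 + ridge n)

/-- `k` minimizes the ridge-type eigenvalue ratio over `1 ≤ j ≤ p - 1`. -/
def IsMRER (k : ℕ) : Prop :=
  (1 ≤ k ∧ k + 1 ≤ p) ∧ ∀ j : ℕ, 1 ≤ j → j + 1 ≤ p → ridgeRatio D k ≤ ridgeRatio D j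

/-- The columns of `V` are orthonormal eigenvectors of the sample target matrix belonging to
its `r` largest eigenvalues. -/
def IsDirectionEstimate {r : ℕ} (V : Matrix (Fin p) (Fin r) ℝ) : Prop :=
  Vᵀ * V = 1 ∧ ∀ j : Fin r, targetMatrixHat D *ᵥ V.col j =
    eig (targetMatrixHat_isHermitian D) ((j : ℕ) + 1) • V.col j

end Sample

/-- The Frobenius norm. -/
def frob {p r : ℕ} (A : Matrix (Fin p) (Fin r) ℝ) : ℝ :=
  Real.sqrt (∑ i, ∑ j, A i j ^ 2)

/-- The Frobenius distance from `V` to the nearest matrix `B * O` with `O` orthogonal. For `B`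
with orthonormal columns these are exactly the orthonormal basis matrices of `span(B)`. -/
def basisDist {p r : ℕ} (V B : Matrix (Fin p) (Fin r) ℝ) : ℝ :=
  ⨅ O : Matrix.orthogonalGroup (Fin r) ℝ, frob (V - B * (O : Matrix (Fin r) (Fin r) ℝ))

/-- `T_n = O_p(a_n)`. -/
def IsBigOp {Ω : ℕ → Type*} [∀ n, MeasurableSpace (Ω n)] (μ : ∀ n, Measure (Ω n))
    (T : ∀ n, Ω n → ℝ) (a : ℕ → ℝ) : Prop :=
  ∀ ε : ℝ, 0 < ε → ∃ K : ℝ, 0 < K ∧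
    ∀ᶠ n in atTop, μ n {ω | K * a n < |T n ω|} ≤ ENNReal.ofReal ε

/-! ### Hypotheses on the law of `(X, Y)` -/

section Hypotheses

variable {p : ℕ} (P : Measure (Obs p))

/-- The predictors are standardized (`E X = 0`, `Var X = I`), with fourth moments bounded by `K`
coordinatewise, and `Y` is integrable. -/
structure StandardizedLaw (K : ℝ) : Prop where
  integrable_response : Integrable (fun z : Obs p => z.2) P
  integrable_fourth : ∀ k, Integrable (fun z : Obs p => z.1 k ^ 4) P
  fourth_le : ∀ k, ∫ z, z.1 k ^ 4 ∂P ≤ K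
  mean_zero : ∀ k, ∫ z, z.1 k ∂P = 0
  cov_id : ∀ k l, ∫ z, z.1 k * z.1 l ∂P = if k = l then 1 else 0

/-- `E(bᵀX | BᵀX)` is an affine function of `BᵀX` for every `b`. -/
def LinearityCondition {r : ℕ} (B : Matrix (Fin p) (Fin r) ℝ) : Prop :=
  ∀ b : Fin p → ℝ, ∃ (a : ℝ) (w : Fin r → ℝ),
    P[(fun z : Obs p => b ⬝ᵥ z.1) | MeasurableSpace.comap (reduce B) inferInstance]
      =ᵐ[P] fun z => a + w ⬝ᵥ reduce B z

/-- `B` is an orthonormal basis matrix of the central mean subspace, which coincides with the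
central subspace; the latter exists, that is, it is itself sufficient. The linearity condition
holds, the fourth moments of `BᵀX` are bounded by `K`, and the eigenvalues satisfy
`c ≤ λ_r ≤ λ_1 ≤ C`. -/
structure SDRConditions [IsFiniteMeasure P] {r : ℕ} (B : Matrix (Fin p) (Fin r) ℝ)
    (c C K : ℝ) : Prop where
  orthonormal : Bᵀ * B = 1
  span_eq : colSpan B = centralMeanSubspace P
  central_eq : centralMeanSubspace P = centralSubspace P
  sufficient : IsSufficient P B
  linearity : LinearityCondition P B
  fourth_le : ∀ j, ∫ z, reduce B z j ^ 4 ∂P ≤ K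
  le_eig : c ≤ eig (targetMatrix_isHermitian P) r
  eig_le : eig (targetMatrix_isHermitian P) 1 ≤ C

/-- The null hypothesis, at the parameter `(β₀, ϑ₀)`:
`E(Y | X) = g(β₀ᵀX, ϑ₀)`, and `span(β₀)` is the central mean subspace, of dimension `d`. -/
def NullModel [IsFiniteMeasure P] {d l : ℕ} (g : (Fin d → ℝ) → (Fin l → ℝ) → ℝ)
    (β₀ : Matrix (Fin p) (Fin d) ℝ) (θ₀ : Fin l → ℝ) : Prop :=
  condMeanY P =ᵐ[P] (fun z => g (reduce β₀ z) θ₀) ∧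
    LinearIndependent ℝ β₀.col ∧ colSpan β₀ = centralMeanSubspace P

/-- The alternative hypothesis: `E(Y | X) = G(BᵀX)` for some function `G`, and `E(Y | X)` is not
of the form `g(βᵀX, ϑ)` for any `(β, ϑ)`. -/
def AlternativeModel {d l r : ℕ} (g : (Fin d → ℝ) → (Fin l → ℝ) → ℝ)
    (B : Matrix (Fin p) (Fin r) ℝ) : Prop :=
  (∃ G : (Fin r → ℝ) → ℝ, Measurable G ∧ condMeanY P =ᵐ[P] fun z => G (reduce B z)) ∧
    ∀ (β : Matrix (Fin p) (Fin d) ℝ) (θ : Fin l → ℝ),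
      ¬ (condMeanY P =ᵐ[P] fun z => g (reduce β z) θ)

end Hypotheses

end CSE

end

/-! Both cases follow from one estimate, ‖M̂ − M‖ = O_p(√(p/n)) in Frobenius norm
(`isBigOp_frob_targetMatrixHat_sub`), combined with the shape of M. Sufficiency and the linearity
condition put every vector E[X I(Y ≤ t)] in span(B) (`SDRConditions.proj_cumMean`). Hence M has
range in span(B), its first r eigenvalues lie in [c, C] and the others vanish.

The delicate point is the standardization: Σ̂ − I has Frobenius norm of order p/√n, which is too
large. However, Σ̂^{-1/2} − I is needed only on span(B), where it costs at most ‖(Σ̂ − I)B‖, of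
order √(pr/n). Moreover r ≤ 1/c, because rc ≤ tr M ≤ 1 by Bessel's inequality (`cumMean_sq_le`). So
√(p/n) and √(pr/n) are the same order. The crude bound on Σ̂ − I only serves to keep Σ̂ within 1/2
of I, which p²/n → 0 allows.

No uniform control over t is required: M̂ uses only the thresholds t = Y_j, and the squared error
summed over j has a directly computable expectation. Given the j-th observation, all terms but one
are independent and centered (`sum_kernel_sq`). Markov's inequality then gives the rate.

With δ of order √(p/n), Weyl's inequality leaves r eigenvalues of M̂ above c/2 and the rest within δ
of zero. The ratio at r is at most a constant times δ² + c_n. Before r the ratio stays bounded away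
from zero; after r it is at least c_n/(δ² + c_n). The latter is larger than the ratio at r because
δ⁴ is of order p²/n² = o(1/n), while c_n ≥ 1/n eventually. For the directions, a sin θ bound
(`frob_sub_proj_le`) and a polar decomposition (`basisDist_le_of_frob_le`) turn the matrix error
into a distance between bases. -/

noncomputable section

namespace CSE

/-! ### The Frobenius norm -/

section Frobenius

attribute [local instance] Matrix.frobeniusNormedAddCommGroup Matrix.frobeniusNormedSpace

variable {a b k : ℕ}

lemma frob_eq_norm (A : Matrix (Fin a) (Fin b) ℝ) : frob A = ‖A‖ := by
  rw [Matrix.frobenius_norm_def, frob, Real.sqrt_eq_rpow]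
  simp

lemma frob_nonneg (A : Matrix (Fin a) (Fin b) ℝ) : 0 ≤ frob A := Real.sqrt_nonneg _

lemma frob_sq (A : Matrix (Fin a) (Fin b) ℝ) : frob A ^ 2 = ∑ i, ∑ j, A i j ^ 2 :=
  Real.sq_sqrt (by positivity)

lemma frob_add_le (A B : Matrix (Fin a) (Fin b) ℝ) : frob (A + B) ≤ frob A + frob B := by
  simpa only [frob_eq_norm] using norm_add_le A B

lemma frob_sub_le (A B : Matrix (Fin a) (Fin b) ℝ) : frob (A - B) ≤ frob A + frob B := by
  simpa only [frob_eq_norm] using norm_sub_le A B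

lemma frob_neg (A : Matrix (Fin a) (Fin b) ℝ) : frob (-A) = frob A := by
  simp only [frob_eq_norm, norm_neg]

lemma frob_smul (c : ℝ) (A : Matrix (Fin a) (Fin b) ℝ) : frob (c • A) = |c| * frob A := by
  simp only [frob_eq_norm, norm_smul, Real.norm_eq_abs]

lemma frob_mul_le (A : Matrix (Fin a) (Fin b) ℝ) (B : Matrix (Fin b) (Fin k) ℝ) :
    frob (A * B) ≤ frob A * frob B := by
  simpa only [frob_eq_norm] using Matrix.frobenius_norm_mul A B

lemma frob_transpose (A : Matrix (Fin a) (Fin b) ℝ) : frob Aᵀ = frob A := by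
  simp only [frob_eq_norm, Matrix.frobenius_norm_transpose]

end Frobenius

/-! ### Frobenius norms under projections and isometries -/

section FrobeniusIsometry

variable {a b k : ℕ}

lemma frob_sq_eq_trace (A : Matrix (Fin a) (Fin b) ℝ) : frob A ^ 2 = (Aᵀ * A).trace := by
  rw [frob_sq, Finset.sum_comm]
  simp [Matrix.trace, Matrix.mul_apply, sq]

lemma frob_mul_of_orthonormal {U : Matrix (Fin a) (Fin b) ℝ} (hU : Uᵀ * U = 1)
    (A : Matrix (Fin b) (Fin k) ℝ) : frob (U * A) = frob A := by
  rw [← sq_eq_sq₀ (frob_nonneg _) (frob_nonneg _), frob_sq_eq_trace, frob_sq_eq_trace,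
    Matrix.transpose_mul, Matrix.mul_assoc, ← Matrix.mul_assoc Uᵀ, hU, Matrix.one_mul]

/-- Pythagoras for the orthogonal projection V Vᵀ. -/
lemma frob_sub_proj_sq {V : Matrix (Fin a) (Fin b) ℝ} (hV : Vᵀ * V = 1)
    (A : Matrix (Fin a) (Fin k) ℝ) :
    frob (A - V * (Vᵀ * A)) ^ 2 = frob A ^ 2 - frob (Vᵀ * A) ^ 2 := by
  have h1 : Aᵀ * V * Vᵀ * V * Vᵀ * A = Aᵀ * V * Vᵀ * A := by
    rw [Matrix.mul_assoc (Aᵀ * V), hV, Matrix.mul_one]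
  simp only [frob_sq_eq_trace, ← Matrix.trace_sub]
  congr 1
  simp only [Matrix.transpose_sub, Matrix.transpose_mul, Matrix.transpose_transpose,
    Matrix.sub_mul, Matrix.mul_sub, ← Matrix.mul_assoc, h1]
  abel

lemma frob_transpose_mul_le {V : Matrix (Fin a) (Fin b) ℝ} (hV : Vᵀ * V = 1)
    (A : Matrix (Fin a) (Fin k) ℝ) : frob (Vᵀ * A) ≤ frob A := by
  refine (abs_le_of_sq_le_sq' ?_ (frob_nonneg _)).2
  nlinarith [frob_sub_proj_sq hV A, sq_nonneg (frob (A - V * (Vᵀ * A)))]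

lemma frob_sub_mul_transpose_mul_le {V : Matrix (Fin a) (Fin b) ℝ} (hV : Vᵀ * V = 1)
    (A : Matrix (Fin a) (Fin k) ℝ) : frob (A - V * (Vᵀ * A)) ≤ frob A := by
  refine (abs_le_of_sq_le_sq' ?_ (frob_nonneg _)).2
  nlinarith [frob_sub_proj_sq hV A, sq_nonneg (frob (Vᵀ * A))]

lemma frob_mul_le_of_orthonormal {V : Matrix (Fin b) (Fin k) ℝ} (hV : Vᵀ * V = 1)
    (A : Matrix (Fin a) (Fin b) ℝ) : frob (A * V) ≤ frob A := by
  rw [← frob_transpose, Matrix.transpose_mul, ← frob_transpose A]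
  exact frob_transpose_mul_le hV _

/-- Cauchy–Schwarz over pairs of indices. It lets the Frobenius norm replace the operator norm in
Weyl's inequality. -/
lemma abs_dotProduct_mulVec_le (A : Matrix (Fin a) (Fin a) ℝ) (x : Fin a → ℝ) :
    |x ⬝ᵥ (A *ᵥ x)| ≤ frob A * (x ⬝ᵥ x) := by
  refine abs_le_of_sq_le_sq ?_ (mul_nonneg (frob_nonneg _) (Finset.sum_nonneg fun i _ => mul_self_nonneg (x i)))
  have h1 : x ⬝ᵥ (A *ᵥ x) = ∑ z : Fin a × Fin a, A z.1 z.2 * (x z.1 * x z.2) := by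
    rw [Fintype.sum_prod_type]
    simp only [dotProduct, Matrix.mulVec, Finset.mul_sum]
    exact Finset.sum_congr rfl fun i _ => Finset.sum_congr rfl fun j _ => by ring
  rw [h1, mul_pow, frob_sq]
  refine (Finset.sum_mul_sq_le_sq_mul_sq _ _ _).trans_eq ?_
  rw [Fintype.sum_prod_type, Fintype.sum_prod_type, sq (x ⬝ᵥ x)]
  congr 1
  simp only [dotProduct, Finset.sum_mul_sum]
  exact Finset.sum_congr rfl fun i _ => Finset.sum_congr rfl fun j _ => by ring

end FrobeniusIsometry

/-! ### Spectral decompositions -/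

section Spectral

variable {p : ℕ}

lemma exists_spectral_invSqrt {A : Matrix (Fin p) (Fin p) ℝ} (hA : A.IsHermitian) :
    ∃ (U : Matrix (Fin p) (Fin p) ℝ) (d : Fin p → ℝ), Uᵀ * U = 1 ∧ U * Uᵀ = 1 ∧
      A = U * Matrix.diagonal d * Uᵀ ∧
      invSqrt A = U * Matrix.diagonal (fun i => (Real.sqrt (d i))⁻¹) * Uᵀ := by
  refine ⟨hA.eigenvectorUnitary, hA.eigenvalues, ?_, ?_, ?_, ?_⟩
  · simpa [Matrix.star_eq_conjTranspose] using Unitary.coe_star_mul_self hA.eigenvectorUnitary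
  · simpa [Matrix.star_eq_conjTranspose] using Unitary.coe_mul_star_self hA.eigenvectorUnitary
  · conv_lhs => rw [hA.spectral_theorem]
    simp only [Unitary.conjStarAlgAut_apply, Matrix.star_eq_conjTranspose]
    rfl
  · rw [invSqrt, hA.cfc_eq, Matrix.IsHermitian.cfc]
    simp only [Unitary.conjStarAlgAut_apply, Matrix.star_eq_conjTranspose]
    rfl

lemma exists_spectral_eig {A : Matrix (Fin p) (Fin p) ℝ} (hA : A.IsHermitian) :
    ∃ U : Matrix (Fin p) (Fin p) ℝ, Uᵀ * U = 1 ∧ U * Uᵀ = 1 ∧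
      A = U * Matrix.diagonal (fun i : Fin p => eig hA ((i : ℕ) + 1)) * Uᵀ := by
  -- `eigenvalues` is indexed through a bijection with `Fin (card (Fin p))`. Permuting the
  -- eigenvectors by `e` restores the decreasing order used by `eig`.
  set e : Fin p ≃ Fin p := (finCongr (Fintype.card_fin p).symm).trans
    (Fintype.equivOfCardEq (Fintype.card_fin _)) with he
  have hd : (fun i : Fin p => eig hA ((i : ℕ) + 1)) = hA.eigenvalues ∘ e := by
    funext i
    have hi : (i : ℕ) + 1 - 1 < p := by omega
    rw [eig, dif_pos hi]
    simp [he, Matrix.IsHermitian.eigenvalues]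
    rfl
  set U : Matrix (Fin p) (Fin p) ℝ := ↑hA.eigenvectorUnitary with hU
  have h1 : Uᵀ * U = 1 := by
    simpa [Matrix.star_eq_conjTranspose] using Unitary.coe_star_mul_self hA.eigenvectorUnitary
  have h2 : U * Uᵀ = 1 := by
    simpa [Matrix.star_eq_conjTranspose] using Unitary.coe_mul_star_self hA.eigenvectorUnitary
  have h3 : A = U * Matrix.diagonal hA.eigenvalues * Uᵀ := by
    conv_lhs => rw [hA.spectral_theorem]
    simp only [Unitary.conjStarAlgAut_apply, Matrix.star_eq_conjTranspose]
    rfl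
  refine ⟨Matrix.submatrix U id e, ?_, ?_, ?_⟩
  · rw [Matrix.transpose_submatrix, ← Matrix.submatrix_mul Uᵀ U e id e Function.bijective_id, h1,
      Matrix.submatrix_one_equiv]
  · rw [Matrix.transpose_submatrix, Matrix.submatrix_mul_equiv, h2, Matrix.submatrix_id_id]
  · rw [hd, ← Matrix.submatrix_diagonal_equiv, Matrix.transpose_submatrix,
      Matrix.submatrix_mul_equiv, Matrix.submatrix_mul_equiv, ← h3, Matrix.submatrix_id_id]

lemma eig_antitone {A : Matrix (Fin p) (Fin p) ℝ} (hA : A.IsHermitian) {i j : ℕ}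
    (hij : i ≤ j) (hj : j ≤ p) (hp : 0 < p) : eig hA j ≤ eig hA i := by
  have h1 : j - 1 < p := by omega
  have h2 : i - 1 < p := by omega
  rw [eig, eig, dif_pos h1, dif_pos h2]
  exact hA.eigenvalues₀_antitone (by simp only [Fin.mk_le_mk]; omega)

/-- Two functions of one symmetric matrix share their eigenvectors, so comparing them reduces to
comparing scalars. -/
lemma frob_diagonal_conj_le {a : ℕ} {U : Matrix (Fin p) (Fin p) ℝ} (hU : Uᵀ * U = 1)
    {f g : Fin p → ℝ} {c : ℝ} (hc : 0 ≤ c) (hfg : ∀ i, |f i| ≤ c * |g i|)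
    (X : Matrix (Fin p) (Fin a) ℝ) :
    frob (U * Matrix.diagonal f * Uᵀ * X) ≤ c * frob (U * Matrix.diagonal g * Uᵀ * X) := by
  simp only [Matrix.mul_assoc, frob_mul_of_orthonormal hU]
  refine (abs_le_of_sq_le_sq' ?_ (mul_nonneg hc (frob_nonneg _))).2
  rw [mul_pow, frob_sq, frob_sq, Finset.mul_sum]
  refine Finset.sum_le_sum fun i _ => ?_
  rw [Finset.mul_sum]
  refine Finset.sum_le_sum fun j _ => ?_
  rw [Matrix.diagonal_mul, Matrix.diagonal_mul, mul_pow, mul_pow, ← mul_assoc]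
  refine mul_le_mul_of_nonneg_right ?_ (sq_nonneg _)
  have := pow_le_pow_left₀ (abs_nonneg _) (hfg i) 2
  rwa [mul_pow, sq_abs, sq_abs] at this

lemma diagonal_conj_sub_one {U : Matrix (Fin p) (Fin p) ℝ} (hU : U * Uᵀ = 1) (d : Fin p → ℝ) :
    U * Matrix.diagonal d * Uᵀ - 1 = U * Matrix.diagonal (fun i => d i - 1) * Uᵀ := by
  have : Matrix.diagonal (fun i => d i - 1) = Matrix.diagonal d - 1 := by
    rw [← Matrix.diagonal_one, Matrix.diagonal_sub]
  rw [this, Matrix.mul_sub, Matrix.sub_mul, Matrix.mul_one, hU]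

lemma abs_le_frob_diagonal_conj {U : Matrix (Fin p) (Fin p) ℝ} (hU : Uᵀ * U = 1)
    (d : Fin p → ℝ) (i : Fin p) : |d i| ≤ frob (U * Matrix.diagonal d * Uᵀ) := by
  rw [Matrix.mul_assoc, frob_mul_of_orthonormal hU, ← frob_transpose, Matrix.transpose_mul,
    Matrix.transpose_transpose, frob_mul_of_orthonormal hU]
  refine abs_le_of_sq_le_sq ?_ (frob_nonneg _)
  rw [frob_sq]
  calc d i ^ 2 = ((Matrix.diagonal d)ᵀ i i) ^ 2 := by simp
    _ ≤ ∑ j, ((Matrix.diagonal d)ᵀ i j) ^ 2 :=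
      Finset.single_le_sum (f := fun j => ((Matrix.diagonal d)ᵀ i j) ^ 2)
        (fun j _ => sq_nonneg _) (Finset.mem_univ i)
    _ ≤ _ := Finset.single_le_sum (f := fun i => ∑ j, ((Matrix.diagonal d)ᵀ i j) ^ 2)
        (fun j _ => Finset.sum_nonneg fun _ _ => sq_nonneg _) (Finset.mem_univ i)

/-- Near the identity, `A^{-1/2}` behaves as expected. -/
lemma invSqrt_spec {A : Matrix (Fin p) (Fin p) ℝ} (hA : A.IsHermitian)
    (h : frob (A - 1) ≤ 1 / 2) :
    (invSqrt A)ᵀ = invSqrt A ∧ invSqrt A * A * invSqrt A = 1 ∧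
      (∀ {a : ℕ} (X : Matrix (Fin p) (Fin a) ℝ),
        frob ((invSqrt A - 1) * X) ≤ frob ((A - 1) * X)) ∧
      ∀ {a : ℕ} (X : Matrix (Fin p) (Fin a) ℝ), frob (invSqrt A * X) ≤ 2 * frob X := by
  obtain ⟨U, d, h1, h2, h3, h4⟩ := exists_spectral_invSqrt hA
  -- All eigenvalues are within 1/2 of 1, so A is nonsingular.
  have hd : ∀ i, 1 / 2 ≤ d i := by
    intro i
    have := abs_le_frob_diagonal_conj h1 (fun i => d i - 1) i
    rw [← diagonal_conj_sub_one h2, ← h3] at this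
    linarith [(abs_le.1 (this.trans h)).1]
  have hs : ∀ i, 1 / 2 ≤ Real.sqrt (d i) := fun i =>
    Real.le_sqrt_of_sq_le (by linarith [hd i])
  have hss : ∀ i, Real.sqrt (d i) * Real.sqrt (d i) = d i := fun i =>
    Real.mul_self_sqrt (by linarith [hd i])
  refine ⟨?_, ?_, ?_, ?_⟩
  · rw [h4]
    simp [Matrix.transpose_mul, Matrix.mul_assoc]
  · have key : ∀ i, (Real.sqrt (d i))⁻¹ * d i * (Real.sqrt (d i))⁻¹ = 1 := by
      intro i
      have := hs i
      have h0 : Real.sqrt (d i) ≠ 0 := by positivity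
      field_simp
      rw [sq, hss]
    rw [h4]
    calc _ = U * Matrix.diagonal (fun i => (Real.sqrt (d i))⁻¹) * Uᵀ *
          (U * Matrix.diagonal d * Uᵀ) *
          (U * Matrix.diagonal (fun i => (Real.sqrt (d i))⁻¹) * Uᵀ) := by rw [← h3]
      _ = U * Matrix.diagonal (fun i => (Real.sqrt (d i))⁻¹) * (Uᵀ * U) * Matrix.diagonal d
          * (Uᵀ * U) * Matrix.diagonal (fun i => (Real.sqrt (d i))⁻¹) * Uᵀ := by
          simp only [Matrix.mul_assoc]
      _ = _ := by
          rw [h1, Matrix.mul_one, Matrix.mul_one, Matrix.mul_assoc U, Matrix.diagonal_mul_diagonal,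
            Matrix.mul_assoc U, Matrix.diagonal_mul_diagonal]
          simp [key, h2]
  · intro a X
    rw [h4, h3, diagonal_conj_sub_one h2, diagonal_conj_sub_one h2,
      ← one_mul (frob (U * Matrix.diagonal (fun i => d i - 1) * Uᵀ * X))]
    refine frob_diagonal_conj_le h1 zero_le_one (fun i => ?_) X
    have hi := hs i
    have hpos : 0 < Real.sqrt (d i) := by linarith
    -- The denominator is √d + d, and both summands are at least 1/2. Hence |1/√d − 1| ≤ |1 − d|
    -- with constant 1.
    have e1 : (Real.sqrt (d i))⁻¹ - 1 =
        (1 - d i) / (Real.sqrt (d i) * (1 + Real.sqrt (d i))) := by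
      rw [eq_div_iff (by positivity)]
      nth_rewrite 4 [← hss i]
      generalize Real.sqrt (d i) = t at hpos
      field_simp
      ring
    rw [e1, abs_div, abs_sub_comm, one_mul]
    refine div_le_self (abs_nonneg _) ?_
    rw [abs_of_pos (by positivity), mul_add, hss, mul_one]
    linarith [hd i]
  · intro a X
    have := frob_diagonal_conj_le h1 (f := fun i => (Real.sqrt (d i))⁻¹) (g := fun _ => 1)
      (c := 2) (by norm_num) (fun i => ?_) X
    · rw [h4]
      simpa [h2] using this
    · have hi := hs i
      rw [abs_inv, abs_of_pos (by linarith), abs_one, mul_one]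
      calc (Real.sqrt (d i))⁻¹ ≤ (1 / 2 : ℝ)⁻¹ := inv_anti₀ (by norm_num) hi
        _ = 2 := by norm_num

end Spectral

/-! ### Eigenvalue inequalities -/

section Eigenvalues

variable {p : ℕ}

lemma dotProduct_diagonal_conj (U : Matrix (Fin p) (Fin p) ℝ) (d : Fin p → ℝ) (x : Fin p → ℝ) :
    x ⬝ᵥ ((U * Matrix.diagonal d * Uᵀ) *ᵥ x) = ∑ i, d i * (Uᵀ *ᵥ x) i ^ 2 := by
  rw [Matrix.mul_assoc, ← Matrix.mulVec_mulVec, Matrix.dotProduct_mulVec,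
    ← Matrix.mulVec_transpose, ← Matrix.mulVec_mulVec, dotProduct]
  refine Finset.sum_congr rfl fun i _ => ?_
  rw [Matrix.mulVec_diagonal]
  ring

lemma dotProduct_self_eq_sum {U : Matrix (Fin p) (Fin p) ℝ} (hU : U * Uᵀ = 1) (x : Fin p → ℝ) :
    x ⬝ᵥ x = ∑ i, (Uᵀ *ᵥ x) i ^ 2 := by
  have := dotProduct_diagonal_conj U (fun _ => 1) x
  simpa [hU] using this

/-- Courant–Fischer bound: the quadratic form is at most `s` on a subspace of codimension
less than `j`. -/
lemma eig_le_of_forall {A : Matrix (Fin p) (Fin p) ℝ} (hA : A.IsHermitian) {m j : ℕ} {s : ℝ}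
    (T : (Fin p → ℝ) →ₗ[ℝ] (Fin m → ℝ)) (hm : m < j) (hj : j ≤ p)
    (h : ∀ x, T x = 0 → x ⬝ᵥ (A *ᵥ x) ≤ s * (x ⬝ᵥ x)) : eig hA j ≤ s := by
  obtain ⟨U, h1, h2, h3⟩ := exists_spectral_eig hA
  -- A kernel vector satisfies T x = 0 and has no component along the eigenvectors after the j-th.
  -- These are m + (p − j) < p equations, so a nonzero solution exists, and on it the form is at
  -- least `eig hA j` times |x|².
  let S : (Fin p → ℝ) →ₗ[ℝ] (Fin m → ℝ) × (Fin (p - j) → ℝ) :=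
    T.prod ((LinearMap.funLeft ℝ ℝ (fun i : Fin (p - j) => (⟨j + i, by omega⟩ : Fin p))).comp
      Uᵀ.mulVecLin)
  have hker : LinearMap.ker S ≠ ⊥ := by
    apply LinearMap.ker_ne_bot_of_finrank_lt
    rw [Module.finrank_prod]
    simp only [Module.finrank_fintype_fun_eq_card, Fintype.card_fin]
    omega
  obtain ⟨x, hx, hx0⟩ := Submodule.exists_mem_ne_zero_of_ne_bot hker
  have hS : S x = 0 := hx
  have hT : T x = 0 := congrArg Prod.fst hS
  have hz : ∀ i : Fin p, j ≤ i → (Uᵀ *ᵥ x) i = 0 := by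
    intro i hi
    have := congrFun (congrArg Prod.snd hS) ⟨i - j, by omega⟩
    have hi' : (⟨j + (i - j), by omega⟩ : Fin p) = i := by ext; simp; omega
    simpa [S, LinearMap.funLeft, hi', -Matrix.mulVecLin_transpose] using this
  have hx1 : 0 < x ⬝ᵥ x := by
    refine lt_of_le_of_ne (Finset.sum_nonneg fun i _ => mul_self_nonneg (x i)) fun h0 => hx0 ?_
    exact dotProduct_self_eq_zero.1 h0.symm
  have h4 := h x hT
  have h5 : eig hA j * (x ⬝ᵥ x) ≤ x ⬝ᵥ (A *ᵥ x) := by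
    conv_rhs => rw [h3]
    rw [dotProduct_diagonal_conj, dotProduct_self_eq_sum h2, Finset.mul_sum]
    refine Finset.sum_le_sum fun i _ => ?_
    by_cases hi : j ≤ i
    · simp [hz i hi]
    · exact mul_le_mul_of_nonneg_right
        (eig_antitone hA (by omega) hj (by omega)) (sq_nonneg _)
  exact le_of_mul_le_mul_right (h5.trans h4) hx1

/-- Weyl's inequality. -/
lemma eig_le_eig_add {A A' : Matrix (Fin p) (Fin p) ℝ} (hA : A.IsHermitian)
    (hA' : A'.IsHermitian) {j : ℕ} (hj1 : 1 ≤ j) (hj : j ≤ p) :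
    eig hA' j ≤ eig hA j + frob (A' - A) := by
  obtain ⟨U, h1, h2, h3⟩ := exists_spectral_eig hA
  -- The constraints are orthogonality to the j − 1 leading eigenvectors of A.
  refine eig_le_of_forall hA' ((LinearMap.funLeft ℝ ℝ
    (fun i : Fin (j - 1) => (⟨i, by omega⟩ : Fin p))).comp Uᵀ.mulVecLin) (by omega) hj
    fun x hx => ?_
  have hz : ∀ i : Fin p, (i : ℕ) < j - 1 → (Uᵀ *ᵥ x) i = 0 := by
    intro i hi
    simpa [LinearMap.funLeft, -Matrix.mulVecLin_transpose] using congrFun hx ⟨i, hi⟩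
  have h4 : x ⬝ᵥ (A *ᵥ x) ≤ eig hA j * (x ⬝ᵥ x) := by
    conv_lhs => rw [h3]
    rw [dotProduct_diagonal_conj, dotProduct_self_eq_sum h2, Finset.mul_sum]
    refine Finset.sum_le_sum fun i _ => ?_
    by_cases hi : (i : ℕ) < j - 1
    · simp [hz i hi]
    · exact mul_le_mul_of_nonneg_right
        (eig_antitone hA (by omega) (by omega) (by omega)) (sq_nonneg _)
  have h5 := (abs_le.1 (abs_dotProduct_mulVec_le (A' - A) x)).2
  rw [Matrix.sub_mulVec, dotProduct_sub] at h5
  linarith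

lemma abs_eig_sub_eig_le {A A' : Matrix (Fin p) (Fin p) ℝ} (hA : A.IsHermitian)
    (hA' : A'.IsHermitian) {j : ℕ} (hj1 : 1 ≤ j) (hj : j ≤ p) :
    |eig hA' j - eig hA j| ≤ frob (A' - A) := by
  have h1 := eig_le_eig_add hA hA' hj1 hj
  have h2 := eig_le_eig_add hA' hA hj1 hj
  rw [← neg_sub A' A, frob_neg] at h2
  rw [abs_le]
  constructor <;> linarith

lemma eig_nonneg {A : Matrix (Fin p) (Fin p) ℝ} (hA : A.IsHermitian)
    (hpos : ∀ x, 0 ≤ x ⬝ᵥ (A *ᵥ x)) {j : ℕ} (hj1 : 1 ≤ j) (hj : j ≤ p) : 0 ≤ eig hA j := by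
  obtain ⟨U, h1, h2, h3⟩ := exists_spectral_eig hA
  have hi : j - 1 < p := by omega
  have h4 := hpos (U *ᵥ Pi.single ⟨j - 1, hi⟩ 1)
  rw [h3, dotProduct_diagonal_conj, Matrix.mulVec_mulVec, h1, Matrix.one_mulVec] at h4
  rw [Finset.sum_eq_single ⟨j - 1, hi⟩ (fun i _ hne => by simp [Pi.single_eq_of_ne hne])
    (by simp)] at h4
  simpa [Nat.sub_add_cancel hj1] using h4

lemma eig_eq_zero_of_eq_mul {A : Matrix (Fin p) (Fin p) ℝ} (hA : A.IsHermitian)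
    (hpos : ∀ x, 0 ≤ x ⬝ᵥ (A *ᵥ x)) {q : ℕ} (B : Matrix (Fin p) (Fin q) ℝ)
    (hB : A * B * Bᵀ = A) {j : ℕ} (hqj : q < j) (hj : j ≤ p) : eig hA j = 0 := by
  refine le_antisymm ?_ (eig_nonneg hA hpos (by omega) hj)
  refine eig_le_of_forall hA Bᵀ.mulVecLin hqj hj fun x hx => ?_
  have hx' : Bᵀ *ᵥ x = 0 := hx
  rw [← hB, ← Matrix.mulVec_mulVec, hx']
  simp

lemma trace_eq_sum_eig {A : Matrix (Fin p) (Fin p) ℝ} (hA : A.IsHermitian) :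
    A.trace = ∑ i : Fin p, eig hA ((i : ℕ) + 1) := by
  obtain ⟨U, h1, h2, h3⟩ := exists_spectral_eig hA
  conv_lhs => rw [h3]
  rw [Matrix.trace_mul_comm, ← Matrix.mul_assoc, h1, Matrix.one_mul, Matrix.trace_diagonal]

/-- Together with tr M ≤ 1 this bounds the structural dimension. -/
lemma natCast_mul_eig_le_trace {A : Matrix (Fin p) (Fin p) ℝ} (hA : A.IsHermitian)
    (hpos : ∀ x, 0 ≤ x ⬝ᵥ (A *ᵥ x)) {q : ℕ} (hq : q ≤ p) :
    q * eig hA q ≤ A.trace := by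
  rw [trace_eq_sum_eig hA, Fin.sum_univ_eq_sum_range (fun i => eig hA (i + 1)) p]
  calc (q : ℝ) * eig hA q = ∑ i ∈ Finset.range q, eig hA q := by simp
    _ ≤ ∑ i ∈ Finset.range q, eig hA (i + 1) := Finset.sum_le_sum fun i hi => by
        have := Finset.mem_range.1 hi
        exact eig_antitone hA (by omega) hq (by omega)
    _ ≤ _ := Finset.sum_le_sum_of_subset_of_nonneg (by simpa using hq) fun i hi _ =>
        eig_nonneg hA hpos (by omega) (by simpa using hi)

end Eigenvalues

/-! ### Perturbation of leading eigenspaces -/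

section Directions

variable {p q : ℕ}

lemma basisDist_nonneg (V B : Matrix (Fin p) (Fin q) ℝ) : 0 ≤ basisDist V B :=
  Real.iInf_nonneg fun _ => frob_nonneg _

lemma basisDist_le (V B : Matrix (Fin p) (Fin q) ℝ) {O : Matrix (Fin q) (Fin q) ℝ}
    (hO : Oᵀ * O = 1) : basisDist V B ≤ frob (V - B * O) := by
  have hO' : O ∈ Matrix.orthogonalGroup (Fin q) ℝ := by
    rw [Matrix.mem_orthogonalGroup_iff']
    exact hO
  exact ciInf_le (f := fun O : Matrix.orthogonalGroup (Fin q) ℝ =>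
    frob (V - B * (O : Matrix (Fin q) (Fin q) ℝ)))
    ⟨0, by rintro _ ⟨O, rfl⟩; exact frob_nonneg _⟩ ⟨O, hO'⟩

/-- BᵀV is nearly orthogonal, and its polar factor O = BᵀV G^{-1/2} is exactly so. Since G − I =
−NᵀN is of second order in the residual N, the correction is harmless: 2‖N‖ + ‖N‖² ≤ 3‖N‖. -/
lemma basisDist_le_of_frob_le {V B : Matrix (Fin p) (Fin q) ℝ} (hV : Vᵀ * V = 1)
    (hB : Bᵀ * B = 1) (h : frob (V - B * (Bᵀ * V)) ≤ 1 / 2) :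
    basisDist V B ≤ 3 * frob (V - B * (Bᵀ * V)) := by
  set N := V - B * (Bᵀ * V) with hN
  set G := Vᵀ * B * (Bᵀ * V) with hG
  have hGN : G - 1 = -(Nᵀ * N) := by
    have h1 : Vᵀ * B * Bᵀ * B * Bᵀ * V = Vᵀ * B * Bᵀ * V := by
      rw [Matrix.mul_assoc (Vᵀ * B), hB, Matrix.mul_one]
    simp only [hG, hN, Matrix.transpose_sub, Matrix.transpose_mul, Matrix.transpose_transpose,
      Matrix.sub_mul, Matrix.mul_sub, ← Matrix.mul_assoc, h1, hV]
    abel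
  have hGH : G.IsHermitian := by
    rw [Matrix.IsHermitian, Matrix.conjTranspose_eq_transpose_of_trivial, hG]
    simp [Matrix.transpose_mul, Matrix.mul_assoc]
  have h0 := frob_nonneg N
  have hG1 : frob (G - 1) ≤ frob N * frob N := by
    rw [hGN, frob_neg]
    exact (frob_mul_le _ _).trans_eq (by rw [frob_transpose])
  obtain ⟨r1, r2, r3, r4⟩ := invSqrt_spec hGH (hG1.trans (by nlinarith))
  set R := invSqrt G
  have hO : (Bᵀ * V * R)ᵀ * (Bᵀ * V * R) = 1 := by
    rw [← r2, hG]
    simp only [Matrix.transpose_mul, Matrix.transpose_transpose, Matrix.mul_assoc, r1]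
  refine (basisDist_le V B hO).trans ?_
  have e1 : V - B * (Bᵀ * V * R) = N * R - V * (R - 1) := by
    simp only [hN, Matrix.sub_mul, Matrix.mul_sub, Matrix.mul_assoc, Matrix.mul_one]
    abel
  have e2 : frob (N * R) ≤ 2 * frob N := by
    rw [← frob_transpose, Matrix.transpose_mul, r1, ← frob_transpose N]
    exact r4 _
  have e3 : frob (R - 1) ≤ frob N * frob N := by
    have := r3 (1 : Matrix (Fin q) (Fin q) ℝ)
    rw [Matrix.mul_one, Matrix.mul_one] at this
    exact this.trans hG1
  rw [e1]
  refine (frob_sub_le _ _).trans ?_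
  rw [frob_mul_of_orthonormal hV]
  nlinarith

/-- A `sin θ` bound for the leading eigenvectors of a perturbation `M'` of a matrix `M` whose
range lies in `span(B)`. -/
lemma frob_sub_proj_le {M M' : Matrix (Fin p) (Fin p) ℝ} {V B : Matrix (Fin p) (Fin q) ℝ}
    (hB : Bᵀ * B = 1) (hV : Vᵀ * V = 1) (hM : B * (Bᵀ * M) = M) {lam : Fin q → ℝ} {s : ℝ}
    (hs : 0 < s) (hlam : ∀ j, s ≤ lam j) (hVM : ∀ j, M' *ᵥ V.col j = lam j • V.col j) :
    frob (V - B * (Bᵀ * V)) ≤ s⁻¹ * frob (M' - M) := by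
  set N := V - B * (Bᵀ * V) with hN
  have h1 : M' * V = V * Matrix.diagonal lam := by
    ext i j
    have := congrFun (hVM j) i
    rw [Matrix.mul_diagonal, mul_comm]
    simpa [Matrix.mulVec, dotProduct, Matrix.mul_apply] using this
  -- I − BBᵀ annihilates M, so only M' − M survives. A lower bound on the eigenvalues then plays the
  -- part of a spectral gap.
  have h2 : N * Matrix.diagonal lam = (M' - M) * V - B * (Bᵀ * ((M' - M) * V)) := by
    have e : B * (Bᵀ * (M * V)) = M * V := by
      rw [← Matrix.mul_assoc Bᵀ, ← Matrix.mul_assoc B, hM]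
    simp only [hN, Matrix.sub_mul, Matrix.mul_sub, h1, e, Matrix.mul_assoc]
    abel
  have h3 : frob (N * Matrix.diagonal lam) ≤ frob (M' - M) := by
    rw [h2]
    exact (frob_sub_mul_transpose_mul_le hB _).trans (frob_mul_le_of_orthonormal hV _)
  rw [← div_eq_inv_mul, le_div_iff₀ hs]
  refine le_trans ?_ h3
  refine (abs_le_of_sq_le_sq' ?_ (frob_nonneg _)).2
  rw [mul_pow, frob_sq, frob_sq, Finset.sum_mul]
  refine Finset.sum_le_sum fun i _ => ?_
  rw [Finset.sum_mul]
  refine Finset.sum_le_sum fun j _ => ?_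
  rw [Matrix.mul_diagonal, mul_pow]
  exact mul_le_mul_of_nonneg_left (pow_le_pow_left₀ hs.le (hlam j) 2) (sq_nonneg _)

end Directions

/-! ### The ridge-type ratio selects the rank -/

section Selection

/-- `h1` excludes k < q, where the numerator is at least m². `h2` excludes k > q, where `lam (k +
1)` may vanish and the ridge alone bounds the numerator from below. -/
lemma eq_of_ridge_ratio_le {lam : ℕ → ℝ} {p q k : ℕ} {C' m δ c₀ : ℝ} (hc₀ : 0 < c₀) (hm : 0 < m)
    (hq : 1 ≤ q) (hqp : q < p) (hk : 1 ≤ k) (hkp : k + 1 ≤ p)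
    (hlow : ∀ j, 1 ≤ j → j ≤ q → m ≤ lam j) (hup : ∀ j, 1 ≤ j → j ≤ q → lam j ≤ C')
    (hsmall : ∀ j, q < j → j ≤ p → |lam j| ≤ δ)
    (h1 : (δ ^ 2 + c₀) * (C' ^ 2 + c₀) < m ^ 2 * m ^ 2) (h2 : (δ ^ 2 + c₀) ^ 2 < c₀ * m ^ 2)
    (hmin : (lam (k + 1) ^ 2 + c₀) / (lam k ^ 2 + c₀) ≤
      (lam (q + 1) ^ 2 + c₀) / (lam q ^ 2 + c₀)) : k = q := by
  have hsq : ∀ j, q < j → j ≤ p → lam j ^ 2 ≤ δ ^ 2 := fun j h1 h2 => by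
    rw [← sq_abs (lam j)]
    exact pow_le_pow_left₀ (abs_nonneg _) (hsmall j h1 h2) 2
  have hls : ∀ j, 1 ≤ j → j ≤ q → m ^ 2 ≤ lam j ^ 2 := fun j h1 h2 =>
    pow_le_pow_left₀ hm.le (hlow j h1 h2) 2
  have a1 := hsq (q + 1) (by omega) (by omega)
  have a2 := hls q hq le_rfl
  rw [div_le_div_iff₀ (by positivity) (by positivity)] at hmin
  by_contra hne
  have hd0 := sq_nonneg δ
  have hm2 : 0 < m ^ 2 := by positivity
  rcases lt_or_gt_of_ne hne with hlt | hgt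
  · have b1 := hls (k + 1) (by omega) (by omega)
    have b2 : lam k ^ 2 ≤ C' ^ 2 := by
      have := hlow k hk hlt.le
      exact pow_le_pow_left₀ (by linarith) (hup k hk hlt.le) 2
    have : m ^ 2 * m ^ 2 ≤ (lam (k + 1) ^ 2 + c₀) * (lam q ^ 2 + c₀) :=
      mul_le_mul (by linarith) (by linarith) hm2.le (by positivity)
    have : (lam (q + 1) ^ 2 + c₀) * (lam k ^ 2 + c₀) ≤ (δ ^ 2 + c₀) * (C' ^ 2 + c₀) :=
      mul_le_mul (by linarith) (by linarith) (by positivity) (by positivity)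
    linarith
  · have b1 := hsq k hgt (by omega)
    have : c₀ * m ^ 2 ≤ (lam (k + 1) ^ 2 + c₀) * (lam q ^ 2 + c₀) :=
      mul_le_mul (by nlinarith [sq_nonneg (lam (k + 1))]) (by linarith) hm2.le (by positivity)
    have : (lam (q + 1) ^ 2 + c₀) * (lam k ^ 2 + c₀) ≤ (δ ^ 2 + c₀) ^ 2 := by
      rw [sq (δ ^ 2 + c₀)]
      exact mul_le_mul (by linarith) (by linarith) (by positivity) (by positivity)
    linarith

end Selection

/-! ### Moments of a standardized law -/

section Moments

variable {p : ℕ} {P : Measure (Obs p)} {K : ℝ}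

lemma StandardizedLaw.integral_sq (hP : StandardizedLaw P K) (k : Fin p) :
    ∫ z, z.1 k ^ 2 ∂P = 1 := by
  have := hP.cov_id k k
  simpa [sq] using this

lemma mul_sq_le_fourth (x y : ℝ) : (x * y) ^ 2 ≤ (x ^ 4 + y ^ 4) / 2 := by
  nlinarith [sq_nonneg (x ^ 2 - y ^ 2)]

lemma memLp_mul_of_fourth {f g : Obs p → ℝ} (hf : Measurable f) (hg : Measurable g)
    (hf4 : Integrable (fun z => f z ^ 4) P) (hg4 : Integrable (fun z => g z ^ 4) P) :
    MemLp (fun z => f z * g z) 2 P := by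
  refine (memLp_two_iff_integrable_sq (by fun_prop)).2 ?_
  refine Integrable.mono' ((hf4.add hg4).div_const 2) (by fun_prop) (ae_of_all _ fun z => ?_)
  rw [Real.norm_of_nonneg (sq_nonneg _)]
  exact mul_sq_le_fourth _ _

/-- A bound on a Bochner integral does not give integrability. It comes instead from the coordinates
of X being in L⁴. -/
lemma StandardizedLaw.integrable_reduce_fourth (hP : StandardizedLaw P K) {q : ℕ}
    (B : Matrix (Fin p) (Fin q) ℝ) (j : Fin q) :
    Integrable (fun z : Obs p => reduce B z j ^ 4) P := by
  have h4 : ∀ k, MemLp (fun z : Obs p => z.1 k) 4 P := fun k => by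
    refine (integrable_norm_rpow_iff (by fun_prop) (by norm_num) (by norm_num)).1 ?_
    refine (hP.integrable_fourth k).congr (ae_of_all _ fun z => ?_)
    have : (4 : ENNReal).toReal = ((4 : ℕ) : ℝ) := by norm_num
    simp only [this, Real.rpow_natCast, Real.norm_eq_abs]
    rw [Even.pow_abs (by decide)]
  have h : MemLp (fun z : Obs p => reduce B z j) 4 P := by
    have e : (fun z : Obs p => reduce B z j) = fun z => ∑ k, B k j * z.1 k := by
      funext z
      simp [reduce, Matrix.mulVec, dotProduct]
    rw [e]
    exact memLp_finsetSum _ fun k _ => (h4 k).const_mul _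
  refine (h.integrable_norm_pow (by norm_num)).congr (ae_of_all _ fun z => ?_)
  simp only [Real.norm_eq_abs]
  exact Even.pow_abs (by decide) _

lemma integral_mul_sq_le_of_fourth {f g : Obs p → ℝ} (hf : Measurable f) (hg : Measurable g)
    (hf4 : Integrable (fun z => f z ^ 4) P) (hg4 : Integrable (fun z => g z ^ 4) P)
    (hfK : ∫ z, f z ^ 4 ∂P ≤ K) (hgK : ∫ z, g z ^ 4 ∂P ≤ K) :
    ∫ z, (f z * g z) ^ 2 ∂P ≤ K := by
  calc ∫ z, (f z * g z) ^ 2 ∂P ≤ ∫ z, (f z ^ 4 + g z ^ 4) / 2 ∂P :=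
        integral_mono ((memLp_mul_of_fourth hf hg hf4 hg4).integrable_sq)
          ((hf4.add hg4).div_const 2) fun z => mul_sq_le_fourth _ _
    _ = (∫ z, f z ^ 4 ∂P + ∫ z, g z ^ 4 ∂P) / 2 := by
        rw [integral_div, integral_add hf4 hg4]
    _ ≤ K := by linarith

variable [IsProbabilityMeasure P]

lemma StandardizedLaw.integrable_sq (hP : StandardizedLaw P K) (k : Fin p) :
    Integrable (fun z : Obs p => z.1 k ^ 2) P := by
  refine Integrable.mono' ((integrable_const 1).add (hP.integrable_fourth k)) (by fun_prop)
    (ae_of_all _ fun z => ?_)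
  rw [Real.norm_of_nonneg (sq_nonneg _), Pi.add_apply]
  nlinarith [sq_nonneg (z.1 k ^ 2 - 1)]

lemma StandardizedLaw.memLp_coord (hP : StandardizedLaw P K) (k : Fin p) :
    MemLp (fun z : Obs p => z.1 k) 2 P :=
  (memLp_two_iff_integrable_sq (by fun_prop)).2 (hP.integrable_sq k)

lemma StandardizedLaw.integrable_coord (hP : StandardizedLaw P K) (k : Fin p) :
    Integrable (fun z : Obs p => z.1 k) P :=
  (hP.memLp_coord k).integrable one_le_two

lemma StandardizedLaw.memLp_dotProduct (hP : StandardizedLaw P K) (b : Fin p → ℝ) :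
    MemLp (fun z : Obs p => b ⬝ᵥ z.1) 2 P := by
  simp only [dotProduct]
  exact memLp_finsetSum _ fun k _ => (hP.memLp_coord k).const_mul (b k)

lemma StandardizedLaw.integrable_dotProduct (hP : StandardizedLaw P K) (b : Fin p → ℝ) :
    Integrable (fun z : Obs p => b ⬝ᵥ z.1) P :=
  (hP.memLp_dotProduct b).integrable one_le_two

lemma StandardizedLaw.integral_dotProduct (hP : StandardizedLaw P K) (b : Fin p → ℝ) :
    ∫ z, b ⬝ᵥ z.1 ∂P = 0 := by
  simp only [dotProduct]
  rw [integral_finsetSum _ fun k _ => (hP.integrable_coord k).const_mul (b k)]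
  simp [integral_const_mul, hP.mean_zero]

lemma StandardizedLaw.integrable_mul_coord (hP : StandardizedLaw P K) (k l : Fin p) :
    Integrable (fun z : Obs p => z.1 k * z.1 l) P :=
  (hP.memLp_coord k).integrable_mul (hP.memLp_coord l)

lemma StandardizedLaw.integral_dotProduct_mul (hP : StandardizedLaw P K) (b c : Fin p → ℝ) :
    ∫ z, (b ⬝ᵥ z.1) * (c ⬝ᵥ z.1) ∂P = b ⬝ᵥ c := by
  have h : ∀ z : Obs p, (b ⬝ᵥ z.1) * (c ⬝ᵥ z.1) =
      ∑ k, ∑ l, b k * c l * (z.1 k * z.1 l) := by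
    intro z
    simp only [dotProduct, Finset.sum_mul_sum]
    exact Finset.sum_congr rfl fun i _ => Finset.sum_congr rfl fun j _ => by ring
  simp only [h]
  rw [integral_finsetSum _ fun k _ => integrable_finsetSum _ fun l _ =>
    (hP.integrable_mul_coord k l).const_mul _]
  refine Finset.sum_congr rfl fun k _ => ?_
  rw [integral_finsetSum _ fun l _ => (hP.integrable_mul_coord k l).const_mul _]
  simp [integral_const_mul, hP.cov_id]

end Moments

/-! ### The cumulative slicing curve and the target matrix -/

section Target

variable {p : ℕ} {P : Measure (Obs p)} [IsProbabilityMeasure P] {K : ℝ}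

lemma measurable_ite_le : Measurable fun z : Obs p × ℝ => if z.1.2 ≤ z.2 then (1 : ℝ) else 0 :=
  Measurable.ite (measurableSet_le (by fun_prop) (by fun_prop)) measurable_const measurable_const

lemma measurable_ite_le_const (t : ℝ) :
    Measurable fun z : Obs p => if z.2 ≤ t then (1 : ℝ) else 0 :=
  measurable_ite_le.comp (measurable_id.prodMk measurable_const)

lemma abs_mul_ite_le (x a b : ℝ) : |x * (if a ≤ b then (1 : ℝ) else 0)| ≤ |x| := by
  split_ifs <;> simp

lemma memLp_ite (t : ℝ) : MemLp (fun z : Obs p => if z.2 ≤ t then (1 : ℝ) else 0) 2 P :=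
  MemLp.of_bound (measurable_ite_le_const t).aestronglyMeasurable 1
    (ae_of_all _ fun z => by split_ifs <;> simp)

lemma measurable_cumMean (k : Fin p) : Measurable fun t => cumMean P t k := by
  unfold cumMean
  refine StronglyMeasurable.measurable ?_
  refine StronglyMeasurable.integral_prod_left'
    (f := fun z : Obs p × ℝ => z.1.1 k * (if z.1.2 ≤ z.2 then (1 : ℝ) else 0)) ?_
  exact (Measurable.mul (by fun_prop) measurable_ite_le).stronglyMeasurable

lemma measurable_cumMean_snd (k : Fin p) : Measurable fun z : Obs p => cumMean P z.2 k :=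
  (measurable_cumMean k).comp measurable_snd

lemma dotProduct_cumMean (hP : StandardizedLaw P K) (b : Fin p → ℝ) (t : ℝ) :
    b ⬝ᵥ cumMean P t = ∫ z, (b ⬝ᵥ z.1) * (if z.2 ≤ t then 1 else 0) ∂P := by
  simp only [dotProduct, cumMean, Finset.sum_mul, mul_assoc]
  have hint : ∀ k, Integrable (fun z : Obs p => z.1 k * (if z.2 ≤ t then (1 : ℝ) else 0)) P :=
    fun k => (hP.memLp_coord k).integrable_mul (memLp_ite t)
  rw [integral_finsetSum _ fun k _ => (hint k).const_mul (b k)]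
  exact Finset.sum_congr rfl fun k _ => (integral_const_mul _ _).symm

/-- Bessel's inequality: the coordinates of X are orthonormal in L²(P), and the entries of E[X I(Y ≤
t)] are the Fourier coefficients of an indicator of norm at most 1. The bound is free of p. -/
lemma cumMean_sq_le (hP : StandardizedLaw P K) (t : ℝ) :
    ∑ k, cumMean P t k ^ 2 ≤ 1 := by
  set a := cumMean P t with ha
  have h1 := hP.memLp_dotProduct a
  have h2 : MemLp (fun z : Obs p => if z.2 ≤ t then (1 : ℝ) else 0) 2 P := memLp_ite t
  have e1 : ∑ k, a k ^ 2 = a ⬝ᵥ a := by simp [dotProduct, sq]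
  have e2 : ∫ z : Obs p, (a ⬝ᵥ z.1) ^ 2 ∂P = a ⬝ᵥ a := by
    simpa only [sq] using hP.integral_dotProduct_mul a a
  have e3 := dotProduct_cumMean hP a t
  rw [← ha] at e3
  have e4 : ∫ z : Obs p, (if z.2 ≤ t then (1 : ℝ) else 0) ^ 2 ∂P ≤ 1 := by
    calc _ ≤ ∫ z : Obs p, (1 : ℝ) ∂P :=
          integral_mono h2.integrable_sq (integrable_const _) fun z => by
            simp only; split_ifs <;> simp
      _ = 1 := by simp
  have h5 : 0 ≤ ∫ z : Obs p, ((a ⬝ᵥ z.1) - (if z.2 ≤ t then (1 : ℝ) else 0)) ^ 2 ∂P :=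
    integral_nonneg fun z => sq_nonneg _
  have h6 : ∫ z : Obs p, ((a ⬝ᵥ z.1) - (if z.2 ≤ t then (1 : ℝ) else 0)) ^ 2 ∂P =
      ∫ z : Obs p, (a ⬝ᵥ z.1) ^ 2 ∂P -
        2 * ∫ z, (a ⬝ᵥ z.1) * (if z.2 ≤ t then 1 else 0) ∂P +
        ∫ z : Obs p, (if z.2 ≤ t then (1 : ℝ) else 0) ^ 2 ∂P := by
    have hm : Integrable (fun z : Obs p => (a ⬝ᵥ z.1) * (if z.2 ≤ t then (1 : ℝ) else 0)) P :=
      h1.integrable_mul h2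
    rw [← integral_const_mul, ← integral_sub h1.integrable_sq (hm.const_mul 2),
      ← integral_add (f := fun z : Obs p => (a ⬝ᵥ z.1) ^ 2 -
        2 * ((a ⬝ᵥ z.1) * (if z.2 ≤ t then (1 : ℝ) else 0)))
        (h1.integrable_sq.sub (hm.const_mul 2)) h2.integrable_sq]
    exact integral_congr_ae (ae_of_all _ fun z => by ring)
  rw [e1]
  linarith

lemma abs_cumMean_le (hP : StandardizedLaw P K) (t : ℝ) (k : Fin p) :
    |cumMean P t k| ≤ 1 := by
  have h := Finset.single_le_sum (f := fun k => cumMean P t k ^ 2) (fun _ _ => sq_nonneg _)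
    (Finset.mem_univ k)
  exact abs_le_one_iff_mul_self_le_one.2 (by nlinarith [cumMean_sq_le hP t])

lemma memLp_cumMean_mul (hP : StandardizedLaw P K) (k l : Fin p) :
    MemLp (fun z : Obs p => cumMean P z.2 k * cumMean P z.2 l) 2 P := by
  refine MemLp.of_bound ((measurable_cumMean_snd k).mul
    (measurable_cumMean_snd l)).aestronglyMeasurable 1 (ae_of_all _ fun z => ?_)
  rw [Real.norm_eq_abs, abs_mul]
  exact mul_le_one₀ (abs_cumMean_le hP _ _) (abs_nonneg _) (abs_cumMean_le hP _ _)

lemma integrable_cumMean_mul (hP : StandardizedLaw P K) (k l : Fin p) :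
    Integrable (fun z : Obs p => cumMean P z.2 k * cumMean P z.2 l) P :=
  (memLp_cumMean_mul hP k l).integrable one_le_two

lemma targetMatrix_apply (k l : Fin p) :
    targetMatrix P k l = ∫ z, cumMean P z.2 k * cumMean P z.2 l ∂P := by
  rw [targetMatrix, Matrix.of_apply, integral_map measurable_snd.aemeasurable]
  exact ((measurable_cumMean k).mul (measurable_cumMean l)).aestronglyMeasurable

lemma targetMatrix_nonneg (hP : StandardizedLaw P K) (x : Fin p → ℝ) :
    0 ≤ x ⬝ᵥ (targetMatrix P *ᵥ x) := by
  have h : x ⬝ᵥ (targetMatrix P *ᵥ x) = ∫ z : Obs p, (x ⬝ᵥ cumMean P z.2) ^ 2 ∂P := by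
    have e : ∀ z : Obs p, (x ⬝ᵥ cumMean P z.2) ^ 2 =
        ∑ k, ∑ l, x k * x l * (cumMean P z.2 k * cumMean P z.2 l) := by
      intro z
      simp only [sq, dotProduct, Finset.sum_mul_sum]
      exact Finset.sum_congr rfl fun i _ => Finset.sum_congr rfl fun j _ => by ring
    simp only [e]
    rw [integral_finsetSum _ fun k _ => integrable_finsetSum _ fun l _ =>
      (integrable_cumMean_mul hP k l).const_mul _]
    simp only [dotProduct, Matrix.mulVec, Finset.mul_sum]
    refine Finset.sum_congr rfl fun k _ => ?_
    rw [integral_finsetSum _ fun l _ => (integrable_cumMean_mul hP k l).const_mul _]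
    refine Finset.sum_congr rfl fun l _ => ?_
    rw [integral_const_mul, targetMatrix_apply]
    ring
  rw [h]
  exact integral_nonneg fun z => sq_nonneg _

lemma trace_targetMatrix_le (hP : StandardizedLaw P K) : (targetMatrix P).trace ≤ 1 := by
  simp only [Matrix.trace, Matrix.diag, targetMatrix_apply]
  rw [← integral_finsetSum _ fun k _ => integrable_cumMean_mul hP k k]
  calc _ ≤ ∫ z : Obs p, (1 : ℝ) ∂P :=
        integral_mono (integrable_finsetSum _ fun k _ => integrable_cumMean_mul hP k k)
          (integrable_const _) fun z => by simpa only [sq] using cumMean_sq_le hP z.2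
    _ = 1 := by simp

lemma sum_integral_cumMean_mul_sq_le (hP : StandardizedLaw P K) :
    ∑ k, ∑ l, ∫ z, (cumMean P z.2 k * cumMean P z.2 l) ^ 2 ∂P ≤ 1 := by
  have hint := fun k l => (memLp_cumMean_mul hP k l).integrable_sq
  simp only [← integral_finsetSum _ fun l _ => hint _ l]
  rw [← integral_finsetSum _ fun k _ => integrable_finsetSum _ fun l _ => hint k l]
  calc _ ≤ ∫ z : Obs p, (1 : ℝ) ∂P :=
        integral_mono (integrable_finsetSum _ fun k _ => integrable_finsetSum _ fun l _ =>
          hint k l) (integrable_const _) fun z => by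
          have h := cumMean_sq_le hP z.2
          have h0 : 0 ≤ ∑ k, cumMean P z.2 k ^ 2 := Finset.sum_nonneg fun _ _ => sq_nonneg _
          simp only [mul_pow]
          rw [← Finset.sum_mul_sum]
          exact mul_le_one₀ h h0 h
    _ = 1 := by simp

end Target

/-! ### The target matrix and the central subspace -/

section Sufficiency

variable {p q : ℕ} {P : Measure (Obs p)} [IsProbabilityMeasure P] {K : ℝ}
  {B : Matrix (Fin p) (Fin q) ℝ}

/-- If `Y` and `X` are conditionally independent given a sub-σ-algebra `m'` of `σ(X)`, then a
function of `X` with zero conditional mean given `m'` is uncorrelated with every event of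
`σ(Y)`. -/
lemma integral_mul_indicator_eq_zero_of_condIndepFun {Ω E : Type*} {m' : MeasurableSpace Ω}
    {m₀ : MeasurableSpace Ω} [StandardBorelSpace Ω] [MeasurableSpace E] {P : Measure Ω}
    [IsFiniteMeasure P] {hm' : m' ≤ m₀} {X : Ω → E} {Y : Ω → ℝ} (hX : Measurable X)
    (hY : Measurable Y) (h : CondIndepFun m' hm' Y X P)
    (hmX : m' ≤ MeasurableSpace.comap X inferInstance) {f : Ω → ℝ} (hf : Integrable f P)
    (hfm : StronglyMeasurable[MeasurableSpace.comap X inferInstance] f)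
    (h0 : P[f | m'] =ᵐ[P] 0) {s : Set ℝ} (hs : MeasurableSet s) :
    ∫ z, f z * (Y ⁻¹' s).indicator (fun _ => (1 : ℝ)) z ∂P = 0 := by
  have hX0 : MeasurableSpace.comap X inferInstance ≤ m₀ := hX.comap_le
  have hsY : MeasurableSet (Y ⁻¹' s) := hY hs
  set S : Set Ω := Y ⁻¹' s with hS
  set one : Set (Ω) → Ω → ℝ := fun u => u.indicator fun _ => (1 : ℝ) with hone
  have hint : ∀ u : Set (Ω), MeasurableSet u → Integrable (one u) P := fun u hu =>
    (integrable_const (1 : ℝ)).indicator hu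
  set g : Ω → ℝ := P[one S | m'] with hg
  have hgm : StronglyMeasurable[m'] g := stronglyMeasurable_condExp
  have hgi : Integrable g P := integrable_condExp
  have hgb : ∀ᵐ z ∂P, ‖g z‖ ≤ 1 := by
    refine ae_bdd_abs_condExp_of_ae_bdd_abs (R := 1) (ae_of_all _ fun z => ?_)
    simp only [hone, Set.indicator]
    split_ifs <;> simp
  have hprod : ∀ {φ : Ω → ℝ}, Integrable φ P → Integrable (φ * g) P := fun hh =>
    hh.mul_bdd (c := 1) (hgm.mono hm').aestronglyMeasurable hgb
  have hci := (condIndepFun_iff_condExp_inter_preimage_eq_mul hY hX).1 h s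
  -- Conditional independence in the form P(Y ∈ s | X) = P(Y ∈ s | m'), checked on the events of
  -- σ(X).
  have hgX : g =ᵐ[P] P[one S | MeasurableSpace.comap X inferInstance] := by
    refine ae_eq_condExp_of_forall_setIntegral_eq hX0 (hint S hsY)
      (fun _ _ _ => hgi.integrableOn) (fun u hu _ => ?_) (hgm.mono hmX).aestronglyMeasurable
    obtain ⟨u', hu', rfl⟩ := hu
    set T : Set (Ω) := X ⁻¹' u'
    have hT : MeasurableSet T := hX hu'
    have e1 : ∫ z in T, g z ∂P = ∫ z, (one T * g) z ∂P := by
      rw [← integral_indicator hT]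
      refine integral_congr_ae (ae_of_all _ fun z => ?_)
      simp only [hone, Pi.mul_apply, Set.indicator]
      split_ifs <;> simp
    have e2 : ∫ z in T, one S z ∂P = ∫ z, one (S ∩ T) z ∂P := by
      rw [← integral_indicator hT, hone]
      simp only [Set.indicator_indicator, Set.inter_comm]
    rw [e1, e2, ← integral_condExp hm', ← integral_condExp hm' (f := one (S ∩ T))]
    refine integral_congr_ae ?_
    filter_upwards [hci u' hs hu', condExp_mul_of_stronglyMeasurable_right hgm
      (hprod (hint T hT)) (hint T hT)] with z h1 h2
    rw [h2]
    refine Eq.trans ?_ h1.symm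
    exact mul_comm _ _
  have hfS : Integrable (f * one S) P := by
    refine hf.mul_bdd (c := 1) (hint S hsY).aestronglyMeasurable (ae_of_all _ fun z => ?_)
    simp only [hone, Set.indicator]
    split_ifs <;> simp
  -- Tower property twice: E[f 1_S] = E[f g] = E[E(f | m') g] = 0.
  calc ∫ z, f z * one S z ∂P = ∫ z, (P[f * one S | MeasurableSpace.comap X inferInstance]) z ∂P := (integral_condExp hX0).symm
    _ = ∫ z, (f * g) z ∂P := by
      refine integral_congr_ae ?_
      filter_upwards [hgX, condExp_mul_of_stronglyMeasurable_left hfm hfS (hint S hsY)]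
        with z h1 h2
      rw [h2, Pi.mul_apply, Pi.mul_apply, h1]
    _ = ∫ z, (P[f * g | m']) z ∂P := (integral_condExp hm').symm
    _ = ∫ z, (0 : ℝ) ∂P := by
      refine integral_congr_ae ?_
      filter_upwards [h0, condExp_mul_of_stronglyMeasurable_right hgm (hprod hf) hf]
        with z h1 h2
      rw [h2, Pi.mul_apply, h1, Pi.zero_apply, zero_mul]
    _ = 0 := by simp

lemma comap_reduce_le (B : Matrix (Fin p) (Fin q) ℝ) :
    MeasurableSpace.comap (reduce B) inferInstance ≤
      MeasurableSpace.comap (fun z : Obs p => z.1) inferInstance := by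
  have e : reduce B = (fun x : Fin p → ℝ => Bᵀ *ᵥ x) ∘ fun z : Obs p => z.1 := rfl
  have hm : Measurable fun x : Fin p → ℝ => Bᵀ *ᵥ x := by
    unfold Matrix.mulVec dotProduct
    fun_prop
  rw [e, ← MeasurableSpace.comap_comp]
  exact MeasurableSpace.comap_mono hm.comap_le

/-- If v = a + wᵀBᵀX is the conditional mean, then E v² = E[v bᵀX] = a E[bᵀX] + (Bw)ᵀb = 0, using E
X = 0, Var X = I and Bᵀb = 0. -/
lemma LinearityCondition.condExp_eq_zero (hP : StandardizedLaw P K) (hB : LinearityCondition P B)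
    {b : Fin p → ℝ} (hb : Bᵀ *ᵥ b = 0) :
    P[(fun z : Obs p => b ⬝ᵥ z.1) | MeasurableSpace.comap (reduce B) inferInstance]
      =ᵐ[P] 0 := by
  obtain ⟨a, w, h⟩ := hB b
  have hm0 : MeasurableSpace.comap (reduce B) inferInstance ≤ Prod.instMeasurableSpace :=
    (measurable_reduce B).comap_le
  have hw : ∀ z : Obs p, w ⬝ᵥ reduce B z = (B *ᵥ w) ⬝ᵥ z.1 := by
    intro z
    rw [reduce, Matrix.dotProduct_mulVec, Matrix.vecMul_transpose]
  set v : Obs p → ℝ := fun z => a + w ⬝ᵥ reduce B z with hv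
  have hvm : StronglyMeasurable[MeasurableSpace.comap (reduce B) inferInstance] v := by
    have h1 : Measurable[MeasurableSpace.comap (reduce B) inferInstance] (reduce B) := comap_measurable _
    have h2 : Measurable fun u : Fin q → ℝ => a + w ⬝ᵥ u := by
      unfold dotProduct
      fun_prop
    exact (h2.comp h1).stronglyMeasurable
  have hL := hP.memLp_dotProduct (B *ᵥ w)
  have hvL : MemLp v 2 P := by
    simp only [hv, hw]
    exact (memLp_const a).add hL
  have hbL : MemLp (fun z : Obs p => b ⬝ᵥ z.1) 2 P := hP.memLp_dotProduct b
  have hbi := hP.integrable_dotProduct b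
  have hvb : Integrable (v * fun z : Obs p => b ⬝ᵥ z.1) P := hvL.integrable_mul hbL
  have e1 : ∫ z, v z ^ 2 ∂P = 0 := by
    calc ∫ z, v z ^ 2 ∂P = ∫ z, (P[v * (fun z : Obs p => b ⬝ᵥ z.1) |
              MeasurableSpace.comap (reduce B) inferInstance]) z ∂P := by
          refine integral_congr_ae ?_
          filter_upwards [h, condExp_mul_of_stronglyMeasurable_left hvm hvb hbi] with z h1 h2
          rw [h2, Pi.mul_apply, h1, sq]
      _ = ∫ z, (v * fun z : Obs p => b ⬝ᵥ z.1) z ∂P := integral_condExp hm0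
      _ = ∫ z, (a * (b ⬝ᵥ z.1) + ((B *ᵥ w) ⬝ᵥ z.1) * (b ⬝ᵥ z.1)) ∂P := by
          refine integral_congr_ae (ae_of_all _ fun z => ?_)
          simp only [Pi.mul_apply, hv, hw]
          ring
      _ = 0 := by
          have hLb : Integrable (fun z : Obs p => ((B *ᵥ w) ⬝ᵥ z.1) * (b ⬝ᵥ z.1)) P :=
            hL.integrable_mul hbL
          rw [integral_add (hbi.const_mul a) hLb, integral_const_mul,
            hP.integral_dotProduct, hP.integral_dotProduct_mul, dotProduct_comm,
            Matrix.dotProduct_mulVec, ← Matrix.mulVec_transpose, hb]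
          simp
  have e2 := (integral_eq_zero_iff_of_nonneg (fun z => sq_nonneg (v z)) hvL.integrable_sq).1 e1
  filter_upwards [h, e2] with z h1 h2
  rw [h1]
  simpa using h2

variable {c C : ℝ}

/-- The residual b of a = E[X I(Y ≤ t)] off span(B) satisfies |b|² = bᵀa = E[bᵀX I(Y ≤ t)]. This
vanishes because E(bᵀX | BᵀX) = 0 and BᵀX is sufficient. -/
lemma SDRConditions.proj_cumMean (hP : StandardizedLaw P K) (hB : SDRConditions P B c C K)
    (t : ℝ) : B *ᵥ (Bᵀ *ᵥ cumMean P t) = cumMean P t := by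
  set a := cumMean P t with ha
  set b := a - B *ᵥ (Bᵀ *ᵥ a) with hb
  have hBb : Bᵀ *ᵥ b = 0 := by
    rw [hb, Matrix.mulVec_sub, Matrix.mulVec_mulVec, hB.orthonormal, Matrix.one_mulVec, sub_self]
  have h1 : b ⬝ᵥ a = 0 := by
    rw [ha, dotProduct_cumMean hP]
    have hm : StronglyMeasurable[MeasurableSpace.comap (fun z : Obs p => z.1) inferInstance]
        (fun z : Obs p => b ⬝ᵥ z.1) := by
      have h2 : Measurable fun x : Fin p → ℝ => b ⬝ᵥ x := by
        unfold dotProduct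
        fun_prop
      exact (h2.comp (comap_measurable _)).stronglyMeasurable
    refine Eq.trans (integral_congr_ae (ae_of_all _ fun z => ?_))
      (integral_mul_indicator_eq_zero_of_condIndepFun measurable_fst measurable_snd hB.sufficient
        (comap_reduce_le B) (hP.integrable_dotProduct b) hm (hB.linearity.condExp_eq_zero hP hBb) (measurableSet_Iic (a := t)))
    simp [Set.indicator]
  have h2 : b ⬝ᵥ b = 0 := by
    conv_lhs => rw [hb]
    rw [sub_dotProduct, dotProduct_comm a, h1, dotProduct_comm, Matrix.dotProduct_mulVec,
      ← Matrix.mulVec_transpose, hBb]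
    simp
  exact (sub_eq_zero.1 (dotProduct_self_eq_zero.1 h2)).symm

lemma SDRConditions.proj_targetMatrix (hP : StandardizedLaw P K)
    (hB : SDRConditions P B c C K) : B * (Bᵀ * targetMatrix P) = targetMatrix P := by
  rw [← Matrix.mul_assoc]
  ext k l
  have h : ∀ t, cumMean P t k = ∑ m, (B * Bᵀ) k m * cumMean P t m := by
    intro t
    have := congrFun (hB.proj_cumMean hP t) k
    rw [Matrix.mulVec_mulVec] at this
    rw [← this]
    rfl
  rw [Matrix.mul_apply, targetMatrix_apply]
  have e : ∀ z : Obs p, cumMean P z.2 k * cumMean P z.2 l =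
      ∑ m, (B * Bᵀ) k m * (cumMean P z.2 m * cumMean P z.2 l) := by
    intro z
    conv_lhs => rw [h z.2]
    rw [Finset.sum_mul]
    exact Finset.sum_congr rfl fun _ _ => by ring
  simp only [e]
  rw [integral_finsetSum _ fun m _ => (integrable_cumMean_mul hP m l).const_mul _]
  exact Finset.sum_congr rfl fun m _ => by rw [integral_const_mul, targetMatrix_apply]

lemma SDRConditions.eig_eq_zero (hP : StandardizedLaw P K) (hB : SDRConditions P B c C K)
    {j : ℕ} (hqj : q < j) (hj : j ≤ p) : eig (targetMatrix_isHermitian P) j = 0 := by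
  refine eig_eq_zero_of_eq_mul _ (targetMatrix_nonneg hP) B ?_ hqj hj
  have h := congrArg Matrix.transpose (hB.proj_targetMatrix hP)
  have hM : (targetMatrix P)ᵀ = targetMatrix P := by
    simpa using (targetMatrix_isHermitian P).eq
  rwa [Matrix.transpose_mul, Matrix.transpose_mul, Matrix.transpose_transpose, hM] at h

lemma SDRConditions.natCast_mul_le_one (hP : StandardizedLaw P K)
    (hB : SDRConditions P B c C K) (hq : q ≤ p) : q * c ≤ 1 :=
  (mul_le_mul_of_nonneg_left hB.le_eig (Nat.cast_nonneg q)).trans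
    ((natCast_mul_eig_le_trace _ (targetMatrix_nonneg hP) hq).trans (trace_targetMatrix_le hP))

end Sufficiency

/-! ### Deterministic error bound for the sample target matrix -/

section SampleBound

variable {n p q : ℕ} (D : Fin n → Obs p)

/-- The matrix `(1/n) ∑ᵢ X_i X_iᵀ` of uncentered second moments. -/
def secondMoment : Matrix (Fin p) (Fin p) ℝ :=
  Matrix.of fun k l => (1 / (n : ℝ)) * ∑ i, (D i).1 k * (D i).1 l

/-- The matrix with columns `(1/n) ∑ᵢ X_i I(Y_i ≤ Y_j)`, `j = 1, …, n`. -/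
def rawCumMean : Matrix (Fin p) (Fin n) ℝ :=
  Matrix.of fun k j => (1 / (n : ℝ)) * ∑ i, (D i).1 k * (if (D i).2 ≤ (D j).2 then 1 else 0)

/-- The matrix with columns `E[X I(Y ≤ t)]` at `t = Y_j`, `j = 1, …, n`. -/
def popCumMean (P : Measure (Obs p)) : Matrix (Fin p) (Fin n) ℝ :=
  Matrix.of fun k j => cumMean P (D j).2 k

/-- The matrix with columns `(1/n) ∑ᵢ (X_i - X̄) I(Y_i ≤ Y_j)`, `j = 1, …, n`. -/
def centeredCumMean : Matrix (Fin p) (Fin n) ℝ :=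
  Matrix.of fun k j => (1 / (n : ℝ)) *
    ∑ i, ((D i).1 k - sampleMean D k) * (if (D i).2 ≤ (D j).2 then 1 else 0)

lemma sampleCov_eq (hn : 0 < n) : sampleCov D =
    secondMoment D - Matrix.vecMulVec (sampleMean D) (sampleMean D) := by
  have hn' : (n : ℝ) ≠ 0 := by positivity
  ext k l
  have h : ∀ k, ∑ i, (D i).1 k = n * sampleMean D k := fun k => by
    rw [sampleMean, ← mul_assoc, mul_one_div_cancel hn', one_mul]
  simp only [sampleCov, secondMoment, Matrix.of_apply, Matrix.sub_apply, Matrix.vecMulVec_apply,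
    sub_mul, mul_sub, Finset.sum_sub_distrib, ← Finset.sum_mul, ← Finset.mul_sum, h,
    Finset.sum_const, Finset.card_univ, Fintype.card_fin, nsmul_eq_mul]
  field_simp
  ring

lemma sampleCov_isHermitian : (sampleCov D).IsHermitian := by
  ext k l
  simp [sampleCov, Matrix.conjTranspose_apply, mul_comm]

lemma frob_vecMulVec (v : Fin p → ℝ) : frob (Matrix.vecMulVec v v) = ∑ k, v k ^ 2 := by
  rw [← sq_eq_sq₀ (frob_nonneg _) (Finset.sum_nonneg fun _ _ => sq_nonneg _), frob_sq,
    sq (∑ k, v k ^ 2), Finset.sum_mul_sum]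
  simp only [Matrix.vecMulVec_apply, mul_pow]

/-- With one column per threshold Y_j, M̂ is a Gram-type product, so a Frobenius bound on the p × n
factor suffices. -/
lemma targetMatrixHat_eq : targetMatrixHat D = (1 / (n : ℝ)) •
    ((invSqrt (sampleCov D) * centeredCumMean D) *
      (invSqrt (sampleCov D) * centeredCumMean D)ᵀ) := by
  have h : ∀ k j, cumMeanHat D (D j).2 k =
      (invSqrt (sampleCov D) * centeredCumMean D) k j := by
    intro k j
    simp only [cumMeanHat, stdPred, Matrix.mul_apply, centeredCumMean, Matrix.of_apply,
      Matrix.mulVec, dotProduct, Finset.mul_sum, Finset.sum_mul, Pi.sub_apply]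
    rw [Finset.sum_comm]
    exact Finset.sum_congr rfl fun _ _ => Finset.sum_congr rfl fun _ _ => by ring
  ext k l
  simp only [targetMatrixHat, Matrix.of_apply, Matrix.smul_apply, smul_eq_mul, h]
  rw [Matrix.mul_apply]
  simp only [Matrix.transpose_apply]

lemma frob_mul_transpose_sub_le {A A₀ : Matrix (Fin p) (Fin n) ℝ} {N η : ℝ} (hN : 0 ≤ N)
    (hη : 0 ≤ η) (h₀ : frob A₀ ≤ N) (h : frob (A - A₀) ≤ N * η) :
    frob (A * Aᵀ - A₀ * A₀ᵀ) ≤ N ^ 2 * (η * (2 + η)) := by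
  have hA : frob A ≤ N + N * η := by
    have := frob_add_le A₀ (A - A₀)
    rw [add_sub_cancel] at this
    linarith
  have e : A * Aᵀ - A₀ * A₀ᵀ = (A - A₀) * Aᵀ + A₀ * (A - A₀)ᵀ := by
    rw [Matrix.transpose_sub, Matrix.sub_mul, Matrix.mul_sub]
    abel
  rw [e]
  calc _ ≤ frob ((A - A₀) * Aᵀ) + frob (A₀ * (A - A₀)ᵀ) := frob_add_le _ _
    _ ≤ frob (A - A₀) * frob A + frob A₀ * frob (A - A₀) :=
      add_le_add ((frob_mul_le _ _).trans_eq (by rw [frob_transpose]))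
        ((frob_mul_le _ _).trans_eq (by rw [frob_transpose]))
    _ ≤ (N * η) * (N + N * η) + N * (N * η) :=
      add_le_add (mul_le_mul h hA (frob_nonneg _) (by positivity))
        (mul_le_mul h₀ h (frob_nonneg _) hN)
    _ = _ := by ring

lemma frob_centeredCumMean_sub_rawCumMean_le {δ : ℝ} (hδ : 0 ≤ δ) (hn : 0 < n)
    (h : ∑ k, sampleMean D k ^ 2 ≤ δ ^ 2) :
    frob (centeredCumMean D - rawCumMean D) ≤ Real.sqrt n * δ := by
  have hn' : (0 : ℝ) < n := by positivity
  refine (abs_le_of_sq_le_sq' ?_ (by positivity)).2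
  rw [mul_pow, Real.sq_sqrt hn'.le, frob_sq]
  have hF : ∀ j, ((1 / (n : ℝ)) * ∑ i, (if (D i).2 ≤ (D j).2 then (1 : ℝ) else 0)) ^ 2 ≤ 1 := by
    intro j
    have h0 : 0 ≤ ∑ i, (if (D i).2 ≤ (D j).2 then (1 : ℝ) else 0) :=
      Finset.sum_nonneg fun i _ => by split_ifs <;> simp
    have h1 : ∑ i, (if (D i).2 ≤ (D j).2 then (1 : ℝ) else 0) ≤ n := by
      calc _ ≤ ∑ i : Fin n, (1 : ℝ) := Finset.sum_le_sum fun i _ => by split_ifs <;> simp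
        _ = n := by simp
    refine pow_le_one₀ (by positivity) ?_
    rw [one_div_mul_eq_div]
    exact div_le_one_of_le₀ h1 hn'.le
  -- Centering subtracts X̄ times the empirical distribution function at Y_j, which is at most 1.
  have e : ∀ k j, (centeredCumMean D - rawCumMean D) k j =
      -(sampleMean D k * ((1 / (n : ℝ)) * ∑ i, (if (D i).2 ≤ (D j).2 then (1 : ℝ) else 0))) := by
    intro k j
    simp only [Matrix.sub_apply, centeredCumMean, rawCumMean, Matrix.of_apply, sub_mul,
      Finset.sum_sub_distrib, ← Finset.mul_sum]
    ring
  calc ∑ k, ∑ j, (centeredCumMean D - rawCumMean D) k j ^ 2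
      ≤ ∑ k, ∑ j : Fin n, sampleMean D k ^ 2 := by
        refine Finset.sum_le_sum fun k _ => Finset.sum_le_sum fun j _ => ?_
        rw [e, neg_sq, mul_pow]
        exact mul_le_of_le_one_right (sq_nonneg _) (hF j)
    _ = n * ∑ k, sampleMean D k ^ 2 := by simp [Finset.mul_sum]
    _ ≤ n * δ ^ 2 := mul_le_mul_of_nonneg_left h hn'.le

lemma frob_popCumMean_le {P : Measure (Obs p)} (ha : ∀ t, ∑ k, cumMean P t k ^ 2 ≤ 1) :
    frob (popCumMean D P) ≤ Real.sqrt n := by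
  refine Real.sqrt_le_sqrt ?_
  rw [Finset.sum_comm]
  calc _ ≤ ∑ j : Fin n, (1 : ℝ) := Finset.sum_le_sum fun j _ => ha _
    _ = n := by simp

/-- The error of the sample target matrix is at most a multiple of `δ` if the errors of the
underlying sample averages are at most `δ`. -/
lemma frob_targetMatrixHat_sub_le {P : Measure (Obs p)} {B : Matrix (Fin p) (Fin q) ℝ}
    (hn : 0 < n) (hB : Bᵀ * B = 1) (ha : ∀ t, ∑ k, cumMean P t k ^ 2 ≤ 1)
    (hproj : ∀ t, B *ᵥ (Bᵀ *ᵥ cumMean P t) = cumMean P t) {δ : ℝ} (hδ0 : 0 ≤ δ)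
    (hδ : δ ≤ 1 / 2) (h1 : frob (secondMoment D - 1) ≤ 1 / 4)
    (h2 : frob ((secondMoment D - 1) * B) ≤ δ) (h3 : ∑ k, sampleMean D k ^ 2 ≤ δ ^ 2)
    (h4 : frob (rawCumMean D - popCumMean D P) ≤ Real.sqrt n * δ)
    (h5 : frob ((1 / (n : ℝ)) • (popCumMean D P * (popCumMean D P)ᵀ) - targetMatrix P) ≤ δ) :
    frob (targetMatrixHat D - targetMatrix P) ≤ 31 * δ := by
  have hn' : (0 : ℝ) < n := by positivity
  set A₀ := popCumMean D P
  set S := sampleCov D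
  set m := sampleMean D
  have hm : frob (Matrix.vecMulVec m m) ≤ δ ^ 2 := (frob_vecMulVec m).trans_le h3
  have hS : S - 1 = (secondMoment D - 1) - Matrix.vecMulVec m m := by
    rw [show S = secondMoment D - Matrix.vecMulVec m m from sampleCov_eq D hn]
    abel
  have hS1 : frob (S - 1) ≤ 1 / 2 := by
    rw [hS]
    refine (frob_sub_le _ _).trans ?_
    nlinarith
  have hS2 : frob ((S - 1) * B) ≤ 2 * δ := by
    rw [hS, Matrix.sub_mul]
    refine (frob_sub_le _ _).trans ?_
    have := (frob_mul_le_of_orthonormal hB (Matrix.vecMulVec m m)).trans hm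
    nlinarith
  obtain ⟨-, -, r3, r4⟩ := invSqrt_spec (sampleCov_isHermitian D) hS1
  have hA₀ : frob A₀ ≤ Real.sqrt n := frob_popCumMean_le D ha
  have hA₀B : B * (Bᵀ * A₀) = A₀ := by
    ext k j
    have := congrFun (hproj (D j).2) k
    rw [Matrix.mulVec_mulVec] at this
    rw [← Matrix.mul_assoc]
    exact this
  set R := invSqrt S
  -- Since A₀ = BBᵀA₀, the standardization error R − I meets A₀ only through (R − I)B.
  have e : R * centeredCumMean D - A₀ =
      R * (centeredCumMean D - A₀) + (R - 1) * B * (Bᵀ * A₀) := by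
    rw [Matrix.mul_assoc (R - 1), hA₀B, Matrix.mul_sub, Matrix.sub_mul, Matrix.one_mul]
    abel
  have hc : frob (centeredCumMean D - A₀) ≤ Real.sqrt n * (2 * δ) := by
    have h := frob_add_le (centeredCumMean D - rawCumMean D) (rawCumMean D - A₀)
    rw [sub_add_sub_cancel] at h
    linarith [frob_centeredCumMean_sub_rawCumMean_le D hδ0 hn h3]
  -- 6 = 2·2 + 2: R at most doubles the error 2δ√n of the curve, and (R − I)B adds 2δ√n.
  have hA : frob (R * centeredCumMean D - A₀) ≤ Real.sqrt n * (6 * δ) := by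
    rw [e]
    have i1 := r4 (centeredCumMean D - A₀)
    have i2 : frob ((R - 1) * B * (Bᵀ * A₀)) ≤ (2 * δ) * Real.sqrt n :=
      (frob_mul_le _ _).trans (mul_le_mul ((r3 B).trans hS2)
        ((frob_transpose_mul_le hB A₀).trans hA₀) (frob_nonneg _) (by positivity))
    have i3 := frob_add_le (R * (centeredCumMean D - A₀)) ((R - 1) * B * (Bᵀ * A₀))
    nlinarith
  have hM := frob_mul_transpose_sub_le (Real.sqrt_nonneg n) (by positivity) hA₀ hA
  rw [Real.sq_sqrt hn'.le] at hM
  have e2 : targetMatrixHat D - targetMatrix P =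
      (1 / (n : ℝ)) • ((R * centeredCumMean D) * (R * centeredCumMean D)ᵀ - A₀ * A₀ᵀ) +
        ((1 / (n : ℝ)) • (A₀ * A₀ᵀ) - targetMatrix P) := by
    rw [targetMatrixHat_eq, smul_sub]
    abel
  rw [e2]
  refine (frob_add_le _ _).trans ?_
  rw [frob_smul, abs_of_pos (by positivity)]
  have hM' := mul_le_mul_of_nonneg_left hM (one_div_pos.2 hn').le
  rw [← mul_assoc, one_div_mul_cancel hn'.ne', one_mul] at hM'
  -- 6δ(2 + 6δ) ≤ 30δ for δ ≤ 1/2, and the last term adds δ.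
  nlinarith

end SampleBound

/-! ### Second moments of sample averages -/

section Averages

variable {α : Type*} [MeasurableSpace α] {P : Measure α}

lemma integral_frob_sq_le {a b : ℕ} {A : α → Matrix (Fin a) (Fin b) ℝ}
    {s : Fin a → Fin b → ℝ}
    (h : ∀ k l, Integrable (fun x => A x k l ^ 2) P ∧ ∫ x, A x k l ^ 2 ∂P ≤ s k l) :
    Integrable (fun x => frob (A x) ^ 2) P ∧ ∫ x, frob (A x) ^ 2 ∂P ≤ ∑ k, ∑ l, s k l := by
  simp only [frob_sq]
  refine ⟨integrable_finsetSum _ fun k _ => integrable_finsetSum _ fun l _ => (h k l).1, ?_⟩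
  rw [integral_finsetSum _ fun k _ => integrable_finsetSum _ fun l _ => (h k l).1]
  refine Finset.sum_le_sum fun k _ => ?_
  rw [integral_finsetSum _ fun l _ => (h k l).1]
  exact Finset.sum_le_sum fun l _ => (h k l).2

variable [IsProbabilityMeasure P]

lemma memLp_comp_eval {n : ℕ} {f : α → ℝ} (hf : MemLp f 2 P) (i : Fin n) :
    MemLp (fun D : Fin n → α => f (D i)) 2 (Measure.pi fun _ => P) :=
  hf.comp_measurePreserving (measurePreserving_eval (fun _ => P) i)

lemma integral_comp_eval {n : ℕ} {f : α → ℝ} (hf : AEStronglyMeasurable f P) (i : Fin n) :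
    ∫ D : Fin n → α, f (D i) ∂(Measure.pi fun _ => P) = ∫ z, f z ∂P := by
  have h := (measurePreserving_eval (fun _ : Fin n => P) i)
  rw [← h.map_eq] at hf
  conv_rhs => rw [← h.map_eq]
  exact (integral_map h.measurable.aemeasurable hf).symm

lemma integral_sum_sub_sq_le {n : ℕ} {f : α → ℝ} (hf : MemLp f 2 P) :
    ∫ D : Fin n → α, (∑ i, f (D i) - n * ∫ z, f z ∂P) ^ 2 ∂(Measure.pi fun _ => P) ≤
      n * ∫ z, f z ^ 2 ∂P := by
  have hS : MemLp (fun D : Fin n → α => ∑ i, f (D i)) 2 (Measure.pi fun _ => P) :=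
    memLp_finsetSum _ fun i _ => memLp_comp_eval hf i
  have h1 := variance_sum_pi (μ := fun _ : Fin n => P) (X := fun _ => f) fun _ => hf
  have e : (∑ i : Fin n, fun D : Fin n → α => f (D i)) = fun D => ∑ i, f (D i) := by
    funext D
    simp
  rw [e, variance_eq_integral hS.aestronglyMeasurable.aemeasurable,
    integral_finsetSum _ fun i _ => (memLp_comp_eval hf i).integrable one_le_two] at h1
  simp only [integral_comp_eval hf.aestronglyMeasurable, Finset.sum_const, Finset.card_univ,
    Fintype.card_fin, nsmul_eq_mul] at h1
  rw [h1]
  exact mul_le_mul_of_nonneg_left (variance_le_expectation_sq hf.aestronglyMeasurable)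
    (Nat.cast_nonneg n)

/-- The mean square error of a sample average. -/
lemma average_sub_integral_sq {n : ℕ} (hn : 0 < n) {f : α → ℝ} (hf : MemLp f 2 P) :
    Integrable (fun D : Fin n → α => ((1 / (n : ℝ)) * ∑ i, f (D i) - ∫ z, f z ∂P) ^ 2)
        (Measure.pi fun _ => P) ∧
      ∫ D : Fin n → α, ((1 / (n : ℝ)) * ∑ i, f (D i) - ∫ z, f z ∂P) ^ 2
        ∂(Measure.pi fun _ => P) ≤ (∫ z, f z ^ 2 ∂P) / n := by
  have hn' : (0 : ℝ) < n := by positivity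
  have hS : MemLp (fun D : Fin n → α => ∑ i, f (D i)) 2 (Measure.pi fun _ => P) :=
    memLp_finsetSum _ fun i _ => memLp_comp_eval hf i
  refine ⟨((hS.const_mul _).sub (memLp_const _)).integrable_sq, ?_⟩
  have e : ∀ D : Fin n → α, ((1 / (n : ℝ)) * ∑ i, f (D i) - ∫ z, f z ∂P) ^ 2 =
      (1 / (n : ℝ) ^ 2) * (∑ i, f (D i) - n * ∫ z, f z ∂P) ^ 2 := by
    intro D
    field_simp
  simp only [e]
  rw [integral_const_mul]
  calc _ ≤ (1 / (n : ℝ) ^ 2) * (n * ∫ z, f z ^ 2 ∂P) :=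
        mul_le_mul_of_nonneg_left (integral_sum_sub_sq_le hf) (by positivity)
    _ = _ := by field_simp

/-- Second moment of a sum of kernels that are centered in the first argument. -/
lemma sum_kernel_sq {n : ℕ} {φ : α → α → ℝ} {h : α → ℝ}
    (hφ : Measurable (Function.uncurry φ)) (hh : MemLp h 2 P)
    (hdom : ∀ z w, |φ z w| ≤ h z) (h0 : ∀ w, ∫ z, φ z w ∂P = 0) {b : ℝ}
    (h2 : ∫ z, h z ^ 2 ∂P ≤ b) (j : Fin n) :
    Integrable (fun D : Fin n → α => (∑ i, φ (D i) (D j)) ^ 2) (Measure.pi fun _ => P) ∧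
      ∫ D : Fin n → α, (∑ i, φ (D i) (D j)) ^ 2 ∂(Measure.pi fun _ => P) ≤ 2 * n * b := by
  obtain ⟨m, rfl⟩ : ∃ m, n = m + 1 := ⟨n - 1, by have := j.isLt; omega⟩
  have hmeas : ∀ i, Measurable fun D : Fin (m + 1) → α => φ (D i) (D j) := fun i => by
    have h : Measurable fun D : Fin (m + 1) → α => (D i, D j) := by fun_prop
    exact hφ.comp h
  have hL : ∀ i, MemLp (fun D : Fin (m + 1) → α => φ (D i) (D j)) 2
      (Measure.pi fun _ => P) := fun i =>
    (memLp_comp_eval hh i).mono' (hmeas i).aestronglyMeasurable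
      (ae_of_all _ fun D => hdom _ _)
  have hS : MemLp (fun D : Fin (m + 1) → α => ∑ i, φ (D i) (D j)) 2
      (Measure.pi fun _ => P) := memLp_finsetSum _ fun i _ => hL i
  refine ⟨hS.integrable_sq, ?_⟩
  have hφw : ∀ w, MemLp (fun z => φ z w) 2 P := fun w =>
    hh.mono' (hφ.comp (measurable_id.prodMk measurable_const)).aestronglyMeasurable
      (ae_of_all _ fun z => hdom z w)
  have hsq : ∀ z w, φ z w ^ 2 ≤ h z ^ 2 := fun z w => by
    rw [← sq_abs (φ z w)]
    exact pow_le_pow_left₀ (abs_nonneg _) (hdom z w) 2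
  have hφ2 : ∀ w, ∫ z, φ z w ^ 2 ∂P ≤ b := fun w =>
    (integral_mono (hφw w).integrable_sq hh.integrable_sq fun z => hsq z w).trans h2
  -- the terms with `i ≠ j`, given the `j`-th observation
  have hoff : ∫ D : Fin (m + 1) → α, (∑ i : Fin m, φ (D (j.succAbove i)) (D j)) ^ 2
      ∂(Measure.pi fun _ => P) ≤ m * b := by
    have hmp := measurePreserving_piFinSuccAbove (fun _ : Fin (m + 1) => P) j
    set G : α × (Fin m → α) → ℝ := fun x => (∑ i : Fin m, φ (x.2 i) x.1) ^ 2 with hG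
    have hGi : Integrable G (P.prod (Measure.pi fun _ => P)) := by
      refine (memLp_finsetSum _ fun i _ => ?_ : MemLp (fun x : α × (Fin m → α) =>
        ∑ i : Fin m, φ (x.2 i) x.1) 2 _).integrable_sq
      have hh' : MemLp (fun x : α × (Fin m → α) => h (x.2 i)) 2
          (P.prod (Measure.pi fun _ => P)) :=
        (memLp_comp_eval hh i).comp_measurePreserving measurePreserving_snd
      have hm : Measurable fun x : α × (Fin m → α) => (x.2 i, x.1) := by fun_prop
      have hm' : Measurable fun x : α × (Fin m → α) => φ (x.2 i) x.1 := hφ.comp hm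
      exact hh'.mono' hm'.aestronglyMeasurable (ae_of_all _ fun x => hdom _ _)
    calc _ = ∫ D : Fin (m + 1) → α, G (MeasurableEquiv.piFinSuccAbove (fun _ => α) j D)
          ∂(Measure.pi fun _ => P) := rfl
      _ = ∫ x, G x ∂(P.prod (Measure.pi fun _ => P)) := hmp.integral_comp' G
      _ = ∫ w, ∫ D, G (w, D) ∂(Measure.pi fun _ => P) ∂P := integral_prod _ hGi
      _ ≤ ∫ w, m * b ∂P := by
        refine integral_mono hGi.integral_prod_left (integrable_const _) fun w => ?_
        have := integral_sum_sub_sq_le (n := m) (hφw w)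
        simp only [h0, mul_zero, sub_zero] at this
        exact this.trans (mul_le_mul_of_nonneg_left (hφ2 w) (Nat.cast_nonneg m))
      _ = m * b := by simp
  have hdiag : ∫ D : Fin (m + 1) → α, φ (D j) (D j) ^ 2 ∂(Measure.pi fun _ => P) ≤ b := by
    calc _ ≤ ∫ D : Fin (m + 1) → α, h (D j) ^ 2 ∂(Measure.pi fun _ => P) :=
          integral_mono (hL j).integrable_sq (memLp_comp_eval hh j).integrable_sq
            fun D => hsq _ _
      _ = ∫ z, h z ^ 2 ∂P :=
          integral_comp_eval (f := fun z => h z ^ 2) hh.integrable_sq.aestronglyMeasurable j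
      _ ≤ b := h2
  have hoffL : MemLp (fun D : Fin (m + 1) → α => ∑ i : Fin m, φ (D (j.succAbove i)) (D j)) 2
      (Measure.pi fun _ => P) := memLp_finsetSum _ fun i _ => hL _
  -- The term i = j is not centered and is split off by (x + y)² ≤ 2x² + 2y². The total is 2b + 2mb
  -- = 2nb.
  calc _ ≤ ∫ D : Fin (m + 1) → α, (2 * φ (D j) (D j) ^ 2 +
        2 * (∑ i : Fin m, φ (D (j.succAbove i)) (D j)) ^ 2) ∂(Measure.pi fun _ => P) := by
        refine integral_mono hS.integrable_sq (((hL j).integrable_sq.const_mul 2).add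
          (hoffL.integrable_sq.const_mul 2)) fun D => ?_
        simp only [Fin.sum_univ_succAbove _ j]
        nlinarith [sq_nonneg (φ (D j) (D j) - ∑ i : Fin m, φ (D (j.succAbove i)) (D j))]
    _ = 2 * ∫ D : Fin (m + 1) → α, φ (D j) (D j) ^ 2 ∂(Measure.pi fun _ => P) +
        2 * ∫ D : Fin (m + 1) → α, (∑ i : Fin m, φ (D (j.succAbove i)) (D j)) ^ 2
          ∂(Measure.pi fun _ => P) := by
        rw [integral_add ((hL j).integrable_sq.const_mul 2) (hoffL.integrable_sq.const_mul 2),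
          integral_const_mul, integral_const_mul]
    _ ≤ 2 * b + 2 * (m * b) := by linarith
    _ = _ := by push_cast; ring

lemma measure_lt_le_of_integral_le {f : α → ℝ} (hf0 : ∀ x, 0 ≤ f x) {a b : ℝ} (ha : 0 < a)
    (hf : Integrable f P ∧ ∫ x, f x ∂P ≤ b) : P {x | a < f x} ≤ ENNReal.ofReal (b / a) := by
  have h := mul_meas_ge_le_integral_of_nonneg (ae_of_all _ hf0) hf.1 a
  have h1 : P.real {x | a ≤ f x} ≤ b / a := by
    rw [le_div_iff₀ ha]
    linarith [hf.2]
  calc P {x | a < f x} ≤ P {x | a ≤ f x} := measure_mono fun x hx => by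
        simp only [Set.mem_ofPred_eq] at hx ⊢
        exact hx.le
    _ = ENNReal.ofReal (P.real {x | a ≤ f x}) := (ofReal_measureReal).symm
    _ ≤ _ := ENNReal.ofReal_le_ofReal h1

end Averages

/-! ### Stochastic error bound for the sample target matrix -/

section StochasticBound

variable {n p q : ℕ} {P : Measure (Obs p)} [IsProbabilityMeasure P] {K c C : ℝ}
  {B : Matrix (Fin p) (Fin q) ℝ}

lemma StandardizedLaw.secondMoment_error (hP : StandardizedLaw P K) (hn : 0 < n) :
    Integrable (fun D : Fin n → Obs p => frob (secondMoment D - 1) ^ 2)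
        (Measure.pi fun _ => P) ∧
      ∫ D : Fin n → Obs p, frob (secondMoment D - 1) ^ 2 ∂(Measure.pi fun _ => P) ≤
        K * p ^ 2 / n := by
  have h := integral_frob_sq_le (P := Measure.pi fun _ : Fin n => P)
    (A := fun D : Fin n → Obs p => secondMoment D - 1) (s := fun _ _ => K / n) fun k l => ?_
  · refine ⟨h.1, h.2.trans_eq ?_⟩
    simp
    ring
  · have h := average_sub_integral_sq hn (memLp_mul_of_fourth (measurable_fst.eval)
      (measurable_fst.eval) (hP.integrable_fourth k) (hP.integrable_fourth l))
    rw [hP.cov_id] at h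
    exact ⟨h.1, h.2.trans (div_le_div_of_nonneg_right (integral_mul_sq_le_of_fourth
      (measurable_fst.eval) (measurable_fst.eval) (hP.integrable_fourth k)
      (hP.integrable_fourth l) (hP.fourth_le k) (hP.fourth_le l)) (Nat.cast_nonneg n))⟩

lemma measurable_reduce_apply (B : Matrix (Fin p) (Fin q) ℝ) (j : Fin q) :
    Measurable fun z : Obs p => reduce B z j :=
  (measurable_pi_apply j).comp (measurable_reduce B)

/-- Each entry is an average of X_k (BᵀX)_j centered at its mean B_kj. There are pq entries instead
of p², which is the gain over `secondMoment_error`. -/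
lemma StandardizedLaw.secondMoment_mul_error (hP : StandardizedLaw P K) (hn : 0 < n)
    (hB : ∀ j, ∫ z, reduce B z j ^ 4 ∂P ≤ K) :
    Integrable (fun D : Fin n → Obs p => frob ((secondMoment D - 1) * B) ^ 2)
        (Measure.pi fun _ => P) ∧
      ∫ D : Fin n → Obs p, frob ((secondMoment D - 1) * B) ^ 2 ∂(Measure.pi fun _ => P) ≤
        K * (p * q) / n := by
  have h := integral_frob_sq_le (P := Measure.pi fun _ : Fin n => P)
    (A := fun D : Fin n → Obs p => (secondMoment D - 1) * B) (s := fun _ _ => K / n)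
    fun k j => ?_
  · refine ⟨h.1, h.2.trans_eq ?_⟩
    simp
    ring
  · have h := average_sub_integral_sq hn (memLp_mul_of_fourth (measurable_fst.eval)
      (measurable_reduce_apply B j) (hP.integrable_fourth k) (hP.integrable_reduce_fourth B j))
    have e1 : ∫ z : Obs p, z.1 k * reduce B z j ∂P = B k j := by
      have := hP.integral_dotProduct_mul (Pi.single k 1) (B.col j)
      simpa [reduce, Matrix.mulVec, dotProduct, Matrix.col, Pi.single_apply] using this
    have e2 : ∀ D : Fin n → Obs p, ((secondMoment D - 1) * B : Matrix (Fin p) (Fin q) ℝ) k j =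
        (1 / (n : ℝ)) * ∑ i, (D i).1 k * reduce B (D i) j - B k j := by
      intro D
      rw [Matrix.sub_mul, Matrix.one_mul, Matrix.sub_apply, Matrix.mul_apply]
      simp only [secondMoment, Matrix.of_apply, reduce, Matrix.mulVec, dotProduct,
        Matrix.transpose_apply, Finset.mul_sum, Finset.sum_mul]
      rw [Finset.sum_comm]
      congr 1
      exact Finset.sum_congr rfl fun _ _ => Finset.sum_congr rfl fun _ _ => by ring
    rw [e1] at h
    simp only [e2]
    exact ⟨h.1, h.2.trans (div_le_div_of_nonneg_right (integral_mul_sq_le_of_fourth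
      (measurable_fst.eval) (measurable_reduce_apply B j) (hP.integrable_fourth k)
      (hP.integrable_reduce_fourth B j) (hP.fourth_le k) (hB j)) (Nat.cast_nonneg n))⟩

lemma StandardizedLaw.sampleMean_error (hP : StandardizedLaw P K) (hn : 0 < n) :
    Integrable (fun D : Fin n → Obs p => ∑ k, sampleMean D k ^ 2) (Measure.pi fun _ => P) ∧
      ∫ D : Fin n → Obs p, ∑ k, sampleMean D k ^ 2 ∂(Measure.pi fun _ => P) ≤ p / n := by
  have h : ∀ k, Integrable (fun D : Fin n → Obs p => sampleMean D k ^ 2)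
      (Measure.pi fun _ => P) ∧
      ∫ D : Fin n → Obs p, sampleMean D k ^ 2 ∂(Measure.pi fun _ => P) ≤ 1 / n := by
    intro k
    have h := average_sub_integral_sq hn (hP.memLp_coord k)
    rw [hP.mean_zero, hP.integral_sq] at h
    simp only [sub_zero] at h
    exact h
  refine ⟨integrable_finsetSum _ fun k _ => (h k).1, ?_⟩
  rw [integral_finsetSum _ fun k _ => (h k).1]
  calc _ ≤ ∑ k : Fin p, 1 / (n : ℝ) := Finset.sum_le_sum fun k _ => (h k).2
    _ = p / n := by simp [div_eq_mul_inv]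

lemma StandardizedLaw.rawCumMean_error (hP : StandardizedLaw P K) (hn : 0 < n) :
    Integrable (fun D : Fin n → Obs p => frob (rawCumMean D - popCumMean D P) ^ 2)
        (Measure.pi fun _ => P) ∧
      ∫ D : Fin n → Obs p, frob (rawCumMean D - popCumMean D P) ^ 2
        ∂(Measure.pi fun _ => P) ≤ 8 * p := by
  have hn' : (0 : ℝ) < n := by positivity
  have h := integral_frob_sq_le (P := Measure.pi fun _ : Fin n => P)
    (A := fun D : Fin n → Obs p => rawCumMean D - popCumMean D P) (s := fun _ _ => 8 / n)
    fun k j => ?_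
  · refine ⟨h.1, h.2.trans_eq ?_⟩
    simp
    field_simp
  · set φ : Obs p → Obs p → ℝ := fun z w =>
      z.1 k * (if z.2 ≤ w.2 then 1 else 0) - cumMean P w.2 k with hφ
    have hh : MemLp (fun z : Obs p => |z.1 k| + 1) 2 P :=
      (hP.memLp_coord k).abs.add (memLp_const 1)
    -- b = 4 comes from (|x| + 1)² ≤ 2x² + 2 and E X_k² = 1. Each of the pn entries then contributes
    -- at most 8/n.
    have h := sum_kernel_sq (φ := φ) (h := fun z => |z.1 k| + 1) (b := 4) ?_ hh ?_ ?_ ?_ j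
    · have e : ∀ D : Fin n → Obs p, (rawCumMean D - popCumMean D P) k j ^ 2 =
          (1 / (n : ℝ) ^ 2) * (∑ i, φ (D i) (D j)) ^ 2 := by
        intro D
        simp only [Matrix.sub_apply, rawCumMean, popCumMean, Matrix.of_apply, hφ,
          Finset.sum_sub_distrib, Finset.sum_const, Finset.card_univ, Fintype.card_fin,
          nsmul_eq_mul]
        field_simp
      simp only [e]
      refine ⟨h.1.const_mul _, ?_⟩
      rw [integral_const_mul]
      calc _ ≤ (1 / (n : ℝ) ^ 2) * (2 * n * 4) :=
            mul_le_mul_of_nonneg_left h.2 (by positivity)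
        _ = 8 / n := by field_simp; norm_num
    · have h1 : Measurable fun x : Obs p × Obs p => if x.1.2 ≤ x.2.2 then (1 : ℝ) else 0 :=
        measurable_ite_le.comp (measurable_fst.prodMk measurable_snd.snd)
      have h2 : Measurable fun x : Obs p × Obs p => x.1.1 k := by fun_prop
      exact (h2.mul h1).sub ((measurable_cumMean_snd k).comp measurable_snd)
    · intro z w
      exact (abs_sub _ _).trans (add_le_add (abs_mul_ite_le _ _ _) (abs_cumMean_le hP _ _))
    · intro w
      have hi : Integrable (fun z : Obs p => z.1 k * (if z.2 ≤ w.2 then (1 : ℝ) else 0)) P :=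
        (hP.memLp_coord k).integrable_mul (memLp_ite _)
      rw [integral_sub hi (integrable_const _), integral_const]
      simp [cumMean]
    · calc ∫ z : Obs p, (|z.1 k| + 1) ^ 2 ∂P ≤ ∫ z : Obs p, (2 * z.1 k ^ 2 + 2) ∂P :=
            integral_mono hh.integrable_sq (((hP.integrable_sq k).const_mul 2).add
              (integrable_const _)) fun z => by
              simp only
              nlinarith [sq_nonneg (|z.1 k| - 1), sq_abs (z.1 k)]
        _ = 4 := by
            rw [integral_add ((hP.integrable_sq k).const_mul 2) (integrable_const _),
              integral_const_mul, hP.integral_sq]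
            norm_num

/-- No factor p² appears: the squared entries of ααᵀ sum to |α|⁴ ≤ 1. -/
lemma StandardizedLaw.popCumMean_error (hP : StandardizedLaw P K) (hn : 0 < n) :
    Integrable (fun D : Fin n → Obs p => frob ((1 / (n : ℝ)) •
        (popCumMean D P * (popCumMean D P)ᵀ) - targetMatrix P) ^ 2) (Measure.pi fun _ => P) ∧
      ∫ D : Fin n → Obs p, frob ((1 / (n : ℝ)) •
        (popCumMean D P * (popCumMean D P)ᵀ) - targetMatrix P) ^ 2
        ∂(Measure.pi fun _ => P) ≤ 1 / n := by
  have h := integral_frob_sq_le (P := Measure.pi fun _ : Fin n => P)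
    (A := fun D : Fin n → Obs p => (1 / (n : ℝ)) •
        (popCumMean D P * (popCumMean D P)ᵀ) - targetMatrix P)
    (s := fun k l => (∫ z, (cumMean P z.2 k * cumMean P z.2 l) ^ 2 ∂P) / n) fun k l => ?_
  · refine ⟨h.1, h.2.trans ?_⟩
    simp only [← Finset.sum_div]
    exact div_le_div_of_nonneg_right (sum_integral_cumMean_mul_sq_le hP) (Nat.cast_nonneg n)
  · have h := average_sub_integral_sq hn (memLp_cumMean_mul hP k l)
    rw [← targetMatrix_apply] at h
    simpa only [Matrix.sub_apply, Matrix.smul_apply, Matrix.mul_apply, Matrix.transpose_apply,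
      popCumMean, Matrix.of_apply, smul_eq_mul] using h

/-- With high probability, the sample target matrix is within a multiple of `√(p/n)` of the
target matrix. -/
lemma SDRConditions.measure_frob_lt_le (hP : StandardizedLaw P K)
    (hB : SDRConditions P B c C K) (hn : 0 < n) (hp : 0 < p) {L : ℝ} (hL : 0 < L)
    (hLn : L * (p / n) ≤ 1 / 4) :
    (Measure.pi fun _ : Fin n => P)
        {D | 31 * Real.sqrt (L * (p / n)) < frob (targetMatrixHat D - targetMatrix P)} ≤
      ENNReal.ofReal (16 * (K * p ^ 2 / n) + (K * q + 10) / L) := by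
  have hn' : (0 : ℝ) < n := by positivity
  have hp' : (1 : ℝ) ≤ p := by exact_mod_cast hp
  have hK : 0 ≤ K := (integral_nonneg fun z => by positivity).trans (hP.fourth_le ⟨0, hp⟩)
  set a : ℝ := L * (p / n) with ha
  have ha0 : 0 < a := by positivity
  set δ := Real.sqrt a with hδ
  have hδ2 : δ ^ 2 = a := Real.sq_sqrt ha0.le
  have hδ0 : 0 ≤ δ := Real.sqrt_nonneg _
  -- This error, of order p/√n, is only kept below the fixed level 1/4. The remaining ones are
  -- compared with δ, giving Kq + 1 + 8 + 1 over L.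
  have b1 := measure_lt_le_of_integral_le (fun D => sq_nonneg (frob (secondMoment D - 1)))
    (by norm_num : (0 : ℝ) < 1 / 16) (hP.secondMoment_error hn)
  have b2 := measure_lt_le_of_integral_le (fun D => sq_nonneg (frob ((secondMoment D - 1) * B)))
    ha0 (hP.secondMoment_mul_error hn hB.fourth_le)
  have b3 := measure_lt_le_of_integral_le
    (fun D => Finset.sum_nonneg fun k _ => sq_nonneg (sampleMean D k)) ha0
    (hP.sampleMean_error hn)
  have b4 := measure_lt_le_of_integral_le
    (fun D => sq_nonneg (frob (rawCumMean D - popCumMean D P))) (mul_pos hn' ha0)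
    (hP.rawCumMean_error hn)
  have b5 := measure_lt_le_of_integral_le (fun D => sq_nonneg (frob ((1 / (n : ℝ)) •
    (popCumMean D P * (popCumMean D P)ᵀ) - targetMatrix P))) ha0 (hP.popCumMean_error hn)
  have hsub : {D : Fin n → Obs p |
      31 * δ < frob (targetMatrixHat D - targetMatrix P)} ⊆
      ((({D | 1 / 16 < frob (secondMoment D - 1) ^ 2} ∪
        {D | a < frob ((secondMoment D - 1) * B) ^ 2}) ∪
        {D | a < ∑ k, sampleMean D k ^ 2}) ∪
        {D | n * a < frob (rawCumMean D - popCumMean D P) ^ 2}) ∪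
        {D | a < frob ((1 / (n : ℝ)) •
          (popCumMean D P * (popCumMean D P)ᵀ) - targetMatrix P) ^ 2} := by
    intro D hD
    by_contra hcon
    simp only [Set.mem_union, Set.mem_ofPred_eq, not_or, not_lt] at hcon
    obtain ⟨⟨⟨⟨c1, c2⟩, c3⟩, c4⟩, c5⟩ := hcon
    rw [Set.mem_ofPred_eq] at hD
    refine absurd hD (not_lt.2 ?_)
    rw [← hδ2] at c2 c3 c4 c5
    have hδh : δ ≤ 1 / 2 := (abs_le_of_sq_le_sq' (by rw [hδ2]; linarith) (by norm_num)).2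
    refine frob_targetMatrixHat_sub_le D hn hB.orthonormal (cumMean_sq_le hP)
      (hB.proj_cumMean hP) hδ0 hδh ?_ ?_ c3 ?_ ?_
    · exact (abs_le_of_sq_le_sq' (by linarith) (by norm_num)).2
    · exact (abs_le_of_sq_le_sq' c2 hδ0).2
    · refine (abs_le_of_sq_le_sq' ?_ (by positivity)).2
      rwa [mul_pow, Real.sq_sqrt hn'.le]
    · exact (abs_le_of_sq_le_sq' c5 hδ0).2
  refine (measure_mono hsub).trans ?_
  refine ((measure_union_le _ _).trans (add_le_add ((measure_union_le _ _).trans (add_le_add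
    ((measure_union_le _ _).trans (add_le_add ((measure_union_le _ _).trans
      (add_le_add b1 b2)) b3)) b4)) b5)).trans ?_
  rw [← ENNReal.ofReal_add (by positivity) (by positivity),
    ← ENNReal.ofReal_add (by positivity) (by positivity),
    ← ENNReal.ofReal_add (by positivity) (by positivity),
    ← ENNReal.ofReal_add (by positivity) (by positivity)]
  refine ENNReal.ofReal_le_ofReal ?_
  have hp0 : (0 : ℝ) < p := by positivity
  have e2 : K * (p * q) / n / a = K * q / L := by rw [ha]; field_simp
  have e3 : (p : ℝ) / n / a = 1 / L := by rw [ha]; field_simp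
  have e4 : 8 * (p : ℝ) / (n * a) = 8 / L := by rw [ha]; field_simp
  have e5 : 1 / (n : ℝ) / a ≤ 1 / L := by
    rw [← e3]
    exact div_le_div_of_nonneg_right (div_le_div_of_nonneg_right hp' hn'.le) ha0.le
  have e6 : (K * q + 10) / L = K * q / L + 1 / L + 8 / L + 1 / L := by ring
  rw [e2, e3, e4, e6]
  linarith

end StochasticBound

/-! ### Consequences of a small error of the sample target matrix -/

section Consequences

variable {n p q : ℕ} {P : Measure (Obs p)} [IsProbabilityMeasure P] {K c C δ : ℝ}
  {B : Matrix (Fin p) (Fin q) ℝ} {D : Fin n → Obs p}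

lemma SDRConditions.le_eig_hat (hB : SDRConditions P B c C K) (hqp : q < p)
    (h : frob (targetMatrixHat D - targetMatrix P) ≤ δ) (hδ : δ ≤ c / 2) {j : ℕ} (hj : 1 ≤ j)
    (hjq : j ≤ q) : c / 2 ≤ eig (targetMatrixHat_isHermitian D) j := by
  have h1 := (abs_le.1 ((abs_eig_sub_eig_le (targetMatrix_isHermitian P)
    (targetMatrixHat_isHermitian D) hj (by omega)).trans h)).1
  have h2 := eig_antitone (targetMatrix_isHermitian P) hjq hqp.le (by omega)
  linarith [hB.le_eig]

lemma SDRConditions.eq_of_isMRER (hP : StandardizedLaw P K) (hB : SDRConditions P B c C K)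
    (hc : 0 < c) (hq : 1 ≤ q) (hqp : q < p) (hr : 0 < ridge n)
    (h : frob (targetMatrixHat D - targetMatrix P) ≤ δ) (hδ : δ ≤ c / 2)
    (h1 : (δ ^ 2 + ridge n) * ((C + c / 2) ^ 2 + ridge n) < (c / 2) ^ 2 * (c / 2) ^ 2)
    (h2 : (δ ^ 2 + ridge n) ^ 2 < ridge n * (c / 2) ^ 2) {k : ℕ} (hk : IsMRER D k) :
    k = q := by
  have hw : ∀ j, 1 ≤ j → j ≤ p → |eig (targetMatrixHat_isHermitian D) j -
      eig (targetMatrix_isHermitian P) j| ≤ δ := fun j hj hjp =>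
    (abs_eig_sub_eig_le _ _ hj hjp).trans h
  refine eq_of_ridge_ratio_le (lam := eig (targetMatrixHat_isHermitian D)) hr (half_pos hc) hq hqp
    hk.1.1 hk.1.2 (fun j hj hjq => hB.le_eig_hat hqp h hδ hj hjq) (fun j hj hjq => ?_)
    (fun j hqj hjp => ?_) h1 h2 (hk.2 q hq hqp)
  · have e1 := (abs_le.1 (hw j hj (by omega))).2
    have e2 := eig_antitone (targetMatrix_isHermitian P) hj (by omega) (by omega)
    linarith [hB.eig_le]
  · have e := hw j (by omega) hjp
    rwa [hB.eig_eq_zero hP hqj hjp, sub_zero] at e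

/-- The sin θ bound at level c/2 contributes 2/c and the polar step 3. The condition δ ≤ c/4 keeps
the residual below 1/2. -/
lemma SDRConditions.basisDist_le (hP : StandardizedLaw P K) (hB : SDRConditions P B c C K)
    (hc : 0 < c) (hqp : q < p) (h : frob (targetMatrixHat D - targetMatrix P) ≤ δ)
    (hδ : δ ≤ c / 4) {V : Matrix (Fin p) (Fin q) ℝ} (hV : IsDirectionEstimate D V) :
    basisDist V B ≤ 6 / c * δ := by
  have h1 := frob_sub_proj_le hB.orthonormal hV.1 (hB.proj_targetMatrix hP) (half_pos hc)
    (fun j => hB.le_eig_hat hqp h (by linarith) (Nat.le_add_left 1 j) j.isLt) hV.2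
  have h2 : (c / 2)⁻¹ * frob (targetMatrixHat D - targetMatrix P) ≤ 2 / c * δ := by
    rw [inv_div]
    exact mul_le_mul_of_nonneg_left h (by positivity)
  have h3 : 2 / c * δ ≤ 1 / 2 := by
    calc 2 / c * δ ≤ 2 / c * (c / 4) := mul_le_mul_of_nonneg_left hδ (by positivity)
      _ = 1 / 2 := by field_simp; norm_num
  have h4 := basisDist_le_of_frob_le hV.1 hB.orthonormal ((h1.trans h2).trans h3)
  calc basisDist V B ≤ 3 * (2 / c * δ) := by linarith
    _ = 6 / c * δ := by ring

end Consequences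

/-! ### Asymptotics -/

section Asymptotics

variable {Ω : ℕ → Type*} [∀ n, MeasurableSpace (Ω n)] {μ : ∀ n, Measure (Ω n)}

lemma IsBigOp.mono {T : ∀ n, Ω n → ℝ} {a b : ℕ → ℝ} (h : IsBigOp μ T a) (hab : ∀ n, a n ≤ b n) :
    IsBigOp μ T b := by
  intro ε hε
  obtain ⟨K, hK, h⟩ := h ε hε
  refine ⟨K, hK, h.mono fun n hn => (measure_mono fun ω hω => ?_).trans hn⟩
  rw [Set.mem_ofPred_eq] at hω ⊢
  exact (mul_le_mul_of_nonneg_left (hab n) hK.le).trans_lt hω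

/-- The sets need not be measurable, since the selector q̂ is arbitrary. Only subadditivity is used.
-/
lemma tendsto_measure_one [∀ n, IsProbabilityMeasure (μ n)] {S : ∀ n, Set (Ω n)}
    (h : ∀ ε : ℝ, 0 < ε → ∀ᶠ n in atTop, μ n (S n)ᶜ ≤ ENNReal.ofReal ε) :
    Tendsto (fun n => μ n (S n)) atTop (𝓝 1) := by
  have h0 : Tendsto (fun n => μ n (S n)ᶜ) atTop (𝓝 0) := by
    rw [ENNReal.tendsto_nhds_zero]
    intro ε hε
    by_cases hε' : ε = ⊤
    · simp [hε']
    · have := h ε.toReal (ENNReal.toReal_pos hε.ne' hε')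
      rwa [ENNReal.ofReal_toReal hε'] at this
  have h1 : Tendsto (fun n => 1 - μ n (S n)ᶜ) atTop (𝓝 1) := by
    simpa using ENNReal.Tendsto.sub tendsto_const_nhds h0 (Or.inl ENNReal.one_ne_top)
  refine tendsto_of_tendsto_of_tendsto_of_le_of_le h1 tendsto_const_nhds (fun n => ?_)
    fun n => prob_le_one
  rw [tsub_le_iff_right, ← measure_univ (μ := μ n), ← Set.union_compl_self (S n)]
  exact measure_union_le _ _

lemma tendsto_ridge : Tendsto ridge atTop (𝓝 0) :=
  (Real.isLittleO_log_id_atTop.tendsto_div_nhds_zero).comp tendsto_natCast_atTop_atTop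

variable {p : ℕ → ℕ}

lemma tendsto_div_of_tendsto_sq_div
    (hp : Tendsto (fun n : ℕ => (p n : ℝ) ^ 2 / n) atTop (𝓝 0)) :
    Tendsto (fun n : ℕ => (p n : ℝ) / n) atTop (𝓝 0) := by
  refine squeeze_zero (fun n => by positivity) (fun n => ?_) hp
  refine div_le_div_of_nonneg_right ?_ (Nat.cast_nonneg n)
  exact_mod_cast Nat.le_self_pow two_ne_zero (p n)

lemma sq_mul_sqrt_div (L : ℝ) (n : ℕ) :
    (L * Real.sqrt ((p n : ℝ) / n)) ^ 2 = L ^ 2 * ((p n : ℝ) / n) := by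
  rw [mul_pow, Real.sq_sqrt (by positivity)]

lemma eventually_mul_sqrt_le (hp : Tendsto (fun n : ℕ => (p n : ℝ) ^ 2 / n) atTop (𝓝 0))
    (L : ℝ) {s : ℝ} (hs : 0 < s) :
    ∀ᶠ n : ℕ in atTop, L * Real.sqrt ((p n : ℝ) / n) ≤ s := by
  have h := ((tendsto_div_of_tendsto_sq_div hp).sqrt).const_mul L
  rw [Real.sqrt_zero, mul_zero] at h
  exact h.eventually_le_const hs

lemma eventually_ridge_conditions
    (hp : Tendsto (fun n : ℕ => (p n : ℝ) ^ 2 / n) atTop (𝓝 0)) (L C' : ℝ) {m : ℝ}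
    (hm : 0 < m) :
    ∀ᶠ n : ℕ in atTop, 0 < ridge n ∧
      ((L * Real.sqrt ((p n : ℝ) / n)) ^ 2 + ridge n) * (C' ^ 2 + ridge n) < m ^ 2 * m ^ 2 ∧
      ((L * Real.sqrt ((p n : ℝ) / n)) ^ 2 + ridge n) ^ 2 < ridge n * m ^ 2 := by
  simp only [sq_mul_sqrt_div]
  have h1 : Tendsto (fun n : ℕ => (L ^ 2 * ((p n : ℝ) / n) + ridge n) * (C' ^ 2 + ridge n))
      atTop (𝓝 0) := by
    have := (((tendsto_div_of_tendsto_sq_div hp).const_mul (L ^ 2)).add tendsto_ridge).mul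
      (tendsto_ridge.const_add (C' ^ 2))
    simpa using this
  have h2 : Tendsto (fun n : ℕ => 2 * L ^ 4 * ((p n : ℝ) ^ 2 / n) + 2 * ridge n)
      atTop (𝓝 0) := by
    have := (hp.const_mul (2 * L ^ 4)).add (tendsto_ridge.const_mul 2)
    simpa using this
  have h3 : ∀ᶠ n : ℕ in atTop, 1 ≤ Real.log n :=
    (Real.tendsto_log_atTop.comp tendsto_natCast_atTop_atTop).eventually_ge_atTop 1
  filter_upwards [h1.eventually_lt_const (by positivity : 0 < m ^ 2 * m ^ 2),
    h2.eventually_lt_const (by positivity : 0 < m ^ 2), h3, eventually_gt_atTop 0]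
    with n e1 e2 e3 hn
  have hn' : (0 : ℝ) < n := by exact_mod_cast hn
  have hr : 1 / (n : ℝ) ≤ ridge n := div_le_div_of_nonneg_right e3 hn'.le
  have hr0 : 0 < ridge n := (one_div_pos.2 hn').trans_le hr
  refine ⟨hr0, e1, ?_⟩
  -- (p/n)² = (p²/n)(1/n) is negligible against the ridge, which is at least 1/n once log n ≥ 1.
  have e4 : (L ^ 2 * ((p n : ℝ) / n)) ^ 2 ≤ L ^ 4 * ((p n : ℝ) ^ 2 / n) * ridge n := by
    calc _ = L ^ 4 * ((p n : ℝ) ^ 2 / n) * (1 / n) := by field_simp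
      _ ≤ _ := mul_le_mul_of_nonneg_left hr (by positivity)
  have e5 := mul_lt_mul_of_pos_left e2 hr0
  nlinarith [sq_nonneg (L ^ 2 * ((p n : ℝ) / n) - ridge n)]

variable {q : ℕ → ℕ} {P : ∀ n, Measure (Obs (p n))} [∀ n, IsProbabilityMeasure (P n)]
  {B : ∀ n, Matrix (Fin (p n)) (Fin (q n)) ℝ} {K c C : ℝ} {D : ∀ n, Ω n → Fin n → Obs (p n)}

/-- The sample target matrix converges in the Frobenius norm at the rate `√(p/n)`. -/
lemma isBigOp_frob_targetMatrixHat_sub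
    (hp : Tendsto (fun n : ℕ => (p n : ℝ) ^ 2 / n) atTop (𝓝 0)) (hc : 0 < c)
    (hP : ∀ n, StandardizedLaw (P n) K) (hq : ∀ n, 1 ≤ q n ∧ q n < p n)
    (hB : ∀ n, SDRConditions (P n) (B n) c C K)
    (hD : ∀ n, HasLaw (D n) (Measure.pi fun _ => P n) (μ n)) :
    IsBigOp μ (fun n ω => frob (targetMatrixHat (D n ω) - targetMatrix (P n)))
      (fun n => Real.sqrt ((p n : ℝ) / n)) := by
  intro ε hε
  have hK : 0 ≤ K := by
    have := (hq 0).2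
    exact (integral_nonneg fun z => by positivity).trans ((hP 0).fourth_le ⟨0, by omega⟩)
  -- Chosen so that (K/c + 10)/L = ε/2, where Kq ≤ K/c. The p²/n term takes the other half.
  set L := 2 * (K / c + 10) / ε with hL
  have hL0 : 0 < L := by positivity
  refine ⟨31 * Real.sqrt L, by positivity, ?_⟩
  have e1 : ∀ᶠ n : ℕ in atTop, 16 * (K * (p n : ℝ) ^ 2 / n) ≤ ε / 2 := by
    have h := hp.const_mul (16 * K)
    rw [mul_zero] at h
    filter_upwards [h.eventually_le_const (half_pos hε)] with n hn
    calc _ = 16 * K * ((p n : ℝ) ^ 2 / n) := by ring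
      _ ≤ _ := hn
  have e2 : ∀ᶠ n : ℕ in atTop, L * ((p n : ℝ) / n) ≤ 1 / 4 := by
    have h := (tendsto_div_of_tendsto_sq_div hp).const_mul L
    rw [mul_zero] at h
    exact h.eventually_le_const (by norm_num)
  filter_upwards [e1, e2, eventually_gt_atTop 0] with n h1 h2 hn
  have hqp := hq n
  have h3 := (hB n).measure_frob_lt_le (hP n) hn (by omega) hL0 h2
  have hqc : K * (q n : ℝ) ≤ K / c := by
    rw [div_eq_mul_one_div]
    refine mul_le_mul_of_nonneg_left ?_ hK
    rw [le_div_iff₀ hc]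
    exact (hB n).natCast_mul_le_one (hP n) hqp.2.le
  have h4 : 16 * (K * (p n : ℝ) ^ 2 / n) + (K * q n + 10) / L ≤ ε := by
    have : (K * q n + 10) / L ≤ (K / c + 10) / L :=
      div_le_div_of_nonneg_right (by linarith) hL0.le
    have e : (K / c + 10) / L = ε / 2 := by
      rw [hL]
      field_simp
    linarith
  have e5 : 31 * Real.sqrt L * Real.sqrt ((p n : ℝ) / n) =
      31 * Real.sqrt (L * ((p n : ℝ) / n)) := by
    rw [Real.sqrt_mul hL0.le, mul_assoc]
  refine le_trans ?_ (h3.trans (ENNReal.ofReal_le_ofReal h4))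
  rw [← (hD n).map_eq]
  -- This inequality for the pushforward requires no measurability of the event.
  refine le_trans (measure_mono fun ω hω => ?_) (Measure.le_map_apply (hD n).aemeasurable _)
  simp only [Set.mem_ofPred_eq, abs_of_nonneg (frob_nonneg _), e5] at hω
  exact hω

/-- Consistency of the estimated dimension and rate of convergence of the estimated
directions. -/
lemma consistency [∀ n, IsProbabilityMeasure (μ n)]
    (hp : Tendsto (fun n : ℕ => (p n : ℝ) ^ 2 / n) atTop (𝓝 0)) (hc : 0 < c)
    (hP : ∀ n, StandardizedLaw (P n) K) (hq : ∀ n, 1 ≤ q n ∧ q n < p n)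
    (hB : ∀ n, SDRConditions (P n) (B n) c C K)
    (hD : ∀ n, HasLaw (D n) (Measure.pi fun _ => P n) (μ n)) {qHat : ∀ n, Ω n → ℕ}
    (hqHat : ∀ n ω, IsMRER (D n ω) (qHat n ω))
    {BHat : ∀ n, Ω n → Matrix (Fin (p n)) (Fin (q n)) ℝ}
    (hBHat : ∀ n ω, IsDirectionEstimate (D n ω) (BHat n ω)) :
    Tendsto (fun n => μ n {ω | qHat n ω = q n}) atTop (𝓝 1) ∧
      IsBigOp μ (fun n ω => basisDist (BHat n ω) (B n))
        (fun n => Real.sqrt ((p n : ℝ) / n)) := by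
  have hM := isBigOp_frob_targetMatrixHat_sub hp hc hP hq hB hD
  refine ⟨tendsto_measure_one fun ε hε => ?_, fun ε hε => ?_⟩
  · obtain ⟨L, hL, h⟩ := hM ε hε
    filter_upwards [h, eventually_mul_sqrt_le hp L (half_pos hc),
      eventually_ridge_conditions hp L (C + c / 2) (half_pos hc)] with n h1 h2 h3
    refine le_trans (measure_mono fun ω hω => ?_) h1
    rw [Set.mem_ofPred_eq, abs_of_nonneg (frob_nonneg _)]
    by_contra hle
    refine hω ?_
    rw [Set.mem_ofPred_eq]
    exact (hB n).eq_of_isMRER (hP n) hc (hq n).1 (hq n).2 h3.1 (not_lt.1 hle) h2 h3.2.1 h3.2.2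
      (hqHat n ω)
  · obtain ⟨L, hL, h⟩ := hM ε hε
    refine ⟨6 / c * L, by positivity, ?_⟩
    filter_upwards [h, eventually_mul_sqrt_le hp L (by positivity : 0 < c / 4)] with n h1 h2
    refine le_trans (measure_mono fun ω hω => ?_) h1
    rw [Set.mem_ofPred_eq, abs_of_nonneg (frob_nonneg _)]
    rw [Set.mem_ofPred_eq, abs_of_nonneg (basisDist_nonneg _ _)] at hω
    by_contra hle
    have := (hB n).basisDist_le (hP n) hc (hq n).2 (not_lt.1 hle) h2 (hBHat n ω)
    rw [← mul_assoc] at this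
    exact absurd hω (not_lt.2 this)

end Asymptotics

end CSE

end

/-! ### Application to the two hypotheses -/

theorem theorem3p1
    {d l : ℕ} (hd : 1 ≤ d) (g : (Fin d → ℝ) → (Fin l → ℝ) → ℝ)
    (p : ℕ → ℕ) (hp : Tendsto (fun n : ℕ => (p n : ℝ) ^ 2 / n) atTop (𝓝 0))
    (c C K : ℝ) (hc : 0 < c)
    (P : ∀ n, Measure (CSE.Obs (p n))) [∀ n, IsProbabilityMeasure (P n)]
    (hP : ∀ n, CSE.StandardizedLaw (P n) K)
    {Ω : ℕ → Type*} [∀ n, MeasurableSpace (Ω n)]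
    (μ : ∀ n, Measure (Ω n)) [∀ n, IsProbabilityMeasure (μ n)]
    (X : ∀ n, Fin n → Ω n → (Fin (p n) → ℝ)) (Y : ∀ n, Fin n → Ω n → ℝ)
    (hlaw : ∀ n i, HasLaw (fun ω => (X n i ω, Y n i ω)) (P n) (μ n))
    (hindep : ∀ n, iIndepFun (fun i ω => (X n i ω, Y n i ω)) (μ n))
    (qHat : ∀ n, Ω n → ℕ)
    (hqHat : ∀ n, 2 ≤ p n → ∀ ω, CSE.IsMRER (fun i => (X n i ω, Y n i ω)) (qHat n ω)) :
    -- under the null hypothesis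
    (∀ (β₀ : ∀ n, Matrix (Fin (p n)) (Fin d) ℝ) (θ₀ : ℕ → Fin l → ℝ)
        (B : ∀ n, Matrix (Fin (p n)) (Fin d) ℝ)
        (BHat : ∀ n, Ω n → Matrix (Fin (p n)) (Fin d) ℝ),
      (∀ n, d < p n) →
      (∀ n, CSE.NullModel (P n) g (β₀ n) (θ₀ n)) →
      (∀ n, CSE.SDRConditions (P n) (B n) c C K) →
      (∀ n ω, CSE.IsDirectionEstimate (fun i => (X n i ω, Y n i ω)) (BHat n ω)) →
        Tendsto (fun n => μ n {ω | qHat n ω = d}) atTop (𝓝 1) ∧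
        CSE.IsBigOp μ (fun n ω => CSE.basisDist (BHat n ω) (B n))
          (fun n => Real.sqrt ((p n : ℝ) / n))) ∧
    -- under the alternative hypothesis
    (∀ (q : ℕ → ℕ) (B : ∀ n, Matrix (Fin (p n)) (Fin (q n)) ℝ)
        (BHat : ∀ n, Ω n → Matrix (Fin (p n)) (Fin (q n)) ℝ),
      (∀ n, 1 ≤ q n ∧ q n < p n) →
      (∀ n, CSE.AlternativeModel (P n) g (B n)) →
      (∀ n, CSE.SDRConditions (P n) (B n) c C K) →
      (∀ n ω, CSE.IsDirectionEstimate (fun i => (X n i ω, Y n i ω)) (BHat n ω)) →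
        Tendsto (fun n => μ n {ω | qHat n ω = q n}) atTop (𝓝 1) ∧
        CSE.IsBigOp μ (fun n ω => CSE.basisDist (BHat n ω) (B n))
          (fun n => Real.sqrt ((p n : ℝ) * (q n : ℝ) / n))) := by
  have hD : ∀ n, HasLaw (fun ω i => (X n i ω, Y n i ω)) (Measure.pi fun _ => P n) (μ n) :=
    fun n => (hindep n).hasLaw_pi (hlaw n)
  constructor
  · intro β₀ θ₀ B BHat hdp _ hB hBHat
    exact CSE.consistency hp hc hP (q := fun _ => d) (fun n => ⟨hd, hdp n⟩) hB hD
      (fun n => hqHat n (by have := hdp n; omega)) hBHat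
  · intro q B BHat hq _ hB hBHat
    obtain ⟨h1, h2⟩ := CSE.consistency hp hc hP hq hB hD
      (fun n => hqHat n (by have := hq n; omega)) hBHat
    -- The common rate √(p/n) is at least as sharp as √(pq/n), because q ≥ 1.
    refine ⟨h1, h2.mono fun n => Real.sqrt_le_sqrt ?_⟩
    refine div_le_div_of_nonneg_right ?_ (Nat.cast_nonneg n)
    exact le_mul_of_one_le_right (Nat.cast_nonneg _) (by exact_mod_cast (hq n).1)
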